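/- Let $K$ be a field extension of a field $F$, let $n \ge 1$ and $d_1,\dots,d_n \ge 1$ be integers, and let $R = K[x_1,\dots,x_n]$. Let $J = (f_1,\dots,f_n) \subset R$ be a generic ideal of type $(n,d_1,\dots,d_n)$ over $F$; that is, each $f_j$ is homogeneous of degree $d_j$, and the coefficients in $f_j$ of all monomials of degree $d_j$, for $j = 1,\dots,n$ taken together, are algebraically independent over $F$. Put $\delta = d_1 + \cdots + d_n - n$. Let $B_i$ be the set of monomials of degree $i$ that do not lie in the initial ideal of $J$ with respect to the graded reverse lexicographic order with $x_1 > \cdots > x_n$. Then for every integer $i$ with $0 \le i \le \delta/2$, $$B_{\delta-i} = x_n^{\delta-2i} B_i := \{x_n^{\delta-2i} m : m \in B_i\}.$$ Moreover $J$ is homogeneous and $A = R/J$ is finite-dimensional over $K$, $\delta$ is the largest degree $i$ with $A_i \neq 0$, and $A$ has the strong Stanley property with $x_n$ as a strong Stanley element: multiplication by $x_n^{\delta-2i}$ is a bijection $A_i \to A_{\delta-i}$ for each $0 \le i \le \lfloor \delta/2 \rfloor$. -/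

import Mathlib

/-- The exponent vectors `Fin n →₀ ℕ`, to be ordered by the graded reverse lexicographic order. -/
def GrevLex (n : ℕ) : Type := Fin n →₀ ℕ

namespace GrevLex

/-- The identification of exponent vectors with elements of `GrevLex n`. -/
def of (n : ℕ) : (Fin n →₀ ℕ) ≃ GrevLex n := Equiv.refl _

noncomputable instance (n : ℕ) : AddCommMonoid (GrevLex n) :=
  inferInstanceAs (AddCommMonoid (Fin n →₀ ℕ))

/-- Exponent vectors are compared by total degree first; ties are broken by reversing the
colexicographic order. -/
noncomputable instance (n : ℕ) : LinearOrder (GrevLex n) :=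
  LinearOrder.lift'
    (fun a : GrevLex n =>
      toLex (((of n).symm a).degree, OrderDual.toDual (toColex ((of n).symm a))))
    (fun _ _ h => (of n).symm.injective
      (toColex.injective (OrderDual.toDual.injective (congrArg Prod.snd (toLex.injective h)))))

theorem of_add {n : ℕ} (a b : Fin n →₀ ℕ) : of n (a + b) = of n a + of n b := rfl

/-- The usual description of the graded reverse lexicographic order with `x₁ > x₂ > ⋯ > xₙ`:
`x^a < x^b` if `deg a < deg b`, or if `deg a = deg b` and the last index at which `a` and `b`
differ has the larger entry in `a`. -/
theorem lt_iff {n : ℕ} {a b : Fin n →₀ ℕ} :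
    of n a < of n b ↔ a.degree < b.degree ∨
      (a.degree = b.degree ∧ ∃ i, (∀ j, i < j → a j = b j) ∧ b i < a i) := by
  change toLex (a.degree, OrderDual.toDual (toColex a)) <
    toLex (b.degree, OrderDual.toDual (toColex b)) ↔ _
  rw [Prod.Lex.toLex_lt_toLex, OrderDual.toDual_lt_toDual, Finsupp.Colex.lt_iff]
  simp [eq_comm]

theorem add_lt_add_right_iff {n : ℕ} (a b c : Fin n →₀ ℕ) :
    of n (a + c) < of n (b + c) ↔ of n a < of n b := by
  simp [lt_iff]

instance (n : ℕ) : IsOrderedAddMonoid (GrevLex n) where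
  add_le_add_left a b h c := by
    by_contra hc
    exact absurd h (not_le.2 ((add_lt_add_right_iff (n := n) b a c).1 (not_le.1 hc)))

theorem of_monotone (n : ℕ) : Monotone (of n) := by
  intro a b h
  by_contra hlt
  have hd : a.degree ≤ b.degree := by
    rw [← add_tsub_cancel_of_le h, map_add]
    exact Nat.le_add_right _ _
  rcases lt_iff.1 (not_le.1 hlt) with h1 | ⟨_, i, _, hi⟩
  · exact absurd hd (not_le.2 h1)
  · have hdeg : a.degree = b.degree := by omega
    have h2 : (b - a).degree = 0 := by
      have h3 := congrArg Finsupp.degree (add_tsub_cancel_of_le h)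
      rw [map_add] at h3
      omega
    have h4 : b - a = 0 := (Finsupp.degree_eq_zero_iff _).1 h2
    have h5 := DFunLike.congr_fun h4 i
    have h6 := h i
    simp at h5
    omega

instance (n : ℕ) : WellFoundedLT (GrevLex n) := by
  have hw : WellQuasiOrderedLE (GrevLex n) :=
    (of_monotone n).wellQuasiOrderedLE_of_wellQuasiOrderedLE_of_surjective (of n).surjective
  infer_instance

end GrevLex

/-- The graded reverse lexicographic order on the monomials in `x₁ > x₂ > ⋯ > xₙ`. -/
noncomputable def grevlex (n : ℕ) : MonomialOrder (Fin n) where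
  syn := GrevLex n
  toSyn := { toEquiv := GrevLex.of n, map_add' := GrevLex.of_add }
  toSyn_monotone := GrevLex.of_monotone n

section StandardMonomials

variable {σ K : Type*} [Field K]

/-- The initial ideal of `I` with respect to the monomial order `m`. -/
noncomputable def initialIdeal (m : MonomialOrder σ) (I : Ideal (MvPolynomial σ K)) :
    Ideal (MvPolynomial σ K) :=
  Ideal.span {t | ∃ f ∈ I, f ≠ 0 ∧ t = m.leadingTerm f}

/-- The standard monomials of degree `i` with respect to `I`: the monomials of degree `i` that do
not lie in the initial ideal of `I`. -/
def standardMonomials (m : MonomialOrder σ) (I : Ideal (MvPolynomial σ K)) (i : ℕ) :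
    Set (MvPolynomial σ K) :=
  {p | ∃ a : σ →₀ ℕ, a.degree = i ∧ p = MvPolynomial.monomial a 1 ∧ p ∉ initialIdeal m I}

end StandardMonomials

section Generic

variable (F : Type*) {K : Type*} [Field F] [Field K] [Algebra F K]

/-- `f₁, …, f_r` are generic forms of degrees `d₁, …, d_r` over `F`: each `f_j` is homogeneous of
degree `d_j`, and the coefficients of all monomials of degree `d_j` in `f_j`, for all `j` together,
are algebraically independent over `F`. -/
def IsGenericForms {n r : ℕ} (d : Fin r → ℕ) (f : Fin r → MvPolynomial (Fin n) K) : Prop :=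
  (∀ j, (f j).IsHomogeneous (d j)) ∧
    AlgebraicIndependent F
      (fun c : (Σ j : Fin r, {a : Fin n →₀ ℕ // a.degree = d j}) =>
        MvPolynomial.coeff c.2.1 (f c.1))

/-- `I` is a generic ideal over `F` of type `(n, d₁, …, d_r)`. -/
def IsGenericIdeal {n r : ℕ} (d : Fin r → ℕ) (I : Ideal (MvPolynomial (Fin n) K)) : Prop :=
  ∃ f : Fin r → MvPolynomial (Fin n) K, IsGenericForms F d f ∧ I = Ideal.span (Set.range f)

end Generic

section Stanley

attribute [local instance] MvPolynomial.gradedAlgebra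

variable {σ K : Type*} [Field K]

/-- The degree `i` part of the graded algebra `A = K[x] / I`, for a homogeneous ideal `I`: the
image in `A` of the forms of degree `i`. -/
noncomputable def gradedPart (I : Ideal (MvPolynomial σ K)) (i : ℕ) :
    Submodule K (MvPolynomial σ K ⧸ I) :=
  (MvPolynomial.homogeneousSubmodule σ K i).map (Ideal.Quotient.mkₐ K I).toLinearMap

/-- `L` is a strong Stanley element on `A = K[x] / I`: the ideal `I` is homogeneous and
zero-dimensional, `L` is a linear form, and if `s` is the largest degree with `A_s ≠ 0`, then
multiplication by `L ^ (s - 2 i)` is a bijection from `A_i` to `A_{s - i}` for all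
`0 ≤ i ≤ ⌊s / 2⌋`. -/
def IsStrongStanleyElement (I : Ideal (MvPolynomial σ K)) (L : MvPolynomial σ K) : Prop :=
  I.IsHomogeneous (MvPolynomial.homogeneousSubmodule σ K) ∧
  Module.Finite K (MvPolynomial σ K ⧸ I) ∧
  L.IsHomogeneous 1 ∧
  ∃ s : ℕ, IsGreatest {i | gradedPart I i ≠ ⊥} s ∧
    ∀ i : ℕ, i ≤ s / 2 →
      Set.BijOn (fun a => Ideal.Quotient.mk I L ^ (s - 2 * i) * a)
        (gradedPart I i) (gradedPart I (s - i))

/-- `A = K[x] / I` has the strong Stanley property. -/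
def HasStrongStanleyProperty (I : Ideal (MvPolynomial σ K)) : Prop :=
  ∃ L : MvPolynomial σ K, IsStrongStanleyElement I L

end Stanley

/-! Write `R` for the polynomial ring and `z` for the last variable. Everything follows from two
facts about `A = R/J`: multiplication by `z ^ (δ - 2i)` maps `A_i` onto `A_{δ-i}`, and the two
spaces have the same dimension.

Surjectivity says that `J + (z ^ e)` contains all forms of degree `j` whenever `δ + e ≤ 2j`. The
dimension of a degree part of an ideal cannot grow when generic coefficients are specialized
(`finrank_degreePart_le_of_isGenericForms`), so one special family of forms suffices, possibly over
another extension of `F`. The family consists of binary forms in consecutive variables `x_{k-1},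
x_k` (with `x_0 = 0`), whose coefficients have nonzero Toeplitz minors. Surjectivity is proved by
adjoining one variable at a time (`StanleyCover.adjoin`): the previous quotient is spanned by
strings `p, ℓp, ℓ²p, …` on primitive elements `p`, and on each string the new binary form gives a
linear recurrence. Its Toeplitz system has only the zero solution modulo multiples of `z ^ e`. No
assumption on the characteristic is needed.

For the dimensions, specialization to the powers `x_k ^ d_k` bounds the Hilbert function of each
partial quotient from above. Adding one form can lower it no further than a regular form does, and
the powers are regular in succession, so the Hilbert functions agree
(`finrank_degreePart_prefixIdeal_eq`). For the powers it counts the lattice points of a box by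
degree, hence is symmetric about `δ/2`.

In the graded reverse lexicographic order, among monomials of one degree a smaller exponent of `z`
means a larger monomial. Surjectivity therefore forces `z ^ (δ - 2i)` to divide each standard
monomial of degree `δ - i`, and injectivity lets this factor be cancelled from or restored to
standard monomials (`standardMonomials_eq_image`). -/

/-! ### Toeplitz minors and linear recurrences -/

section Toeplitz

variable {K : Type*} [Field K]

/-- The `N × N` Toeplitz matrix with entries `γ_{D + s - t}`, the sequence `γ` being truncated to
the indices `0, …, d`. -/
def toeplitz {A : Type*} [Zero A] (γ : ℕ → A) (d D N : ℕ) : Matrix (Fin N) (Fin N) A :=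
  Matrix.of fun s t => if (t : ℕ) ≤ D + s ∧ D + s - t ≤ d then γ (D + s - t) else 0

/-- All Toeplitz minors of the sequence `γ` are nonzero. -/
def ToeplitzRegular (γ : ℕ → K) : Prop :=
  ∀ d D N : ℕ, D ≤ d → (toeplitz γ d D N).det ≠ 0

/-- A sequence of indeterminates has nonzero Toeplitz minors. -/
theorem toeplitzRegular_indeterminates (F : Type*) [Field F] :
    ToeplitzRegular (fun s => algebraMap (MvPolynomial ℕ F)
      (FractionRing (MvPolynomial ℕ F)) (MvPolynomial.X s)) := by
  intro d D N hD
  have h1 : toeplitz (fun s => algebraMap (MvPolynomial ℕ F)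
      (FractionRing (MvPolynomial ℕ F)) (MvPolynomial.X s)) d D N =
      (algebraMap (MvPolynomial ℕ F) (FractionRing (MvPolynomial ℕ F))).mapMatrix
        (toeplitz MvPolynomial.X d D N) := by
    ext s t
    simp only [toeplitz, Matrix.of_apply, RingHom.mapMatrix_apply, Matrix.map_apply]
    split_ifs <;> simp
  rw [h1, ← RingHom.map_det]
  intro h0
  have h2 := (IsFractionRing.injective (MvPolynomial ℕ F)
    (FractionRing (MvPolynomial ℕ F))) (h0.trans (map_zero _).symm)
  -- Setting `X_D = 1` and all other indeterminates to zero turns the matrix into the identity; `D ≤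
  -- d` keeps the diagonal from being truncated.
  have h3 := congrArg (MvPolynomial.eval (fun s => if s = D then (1 : F) else 0)) h2
  rw [RingHom.map_det, map_zero] at h3
  have h4 : (MvPolynomial.eval (fun s => if s = D then (1 : F) else 0)).mapMatrix
      (toeplitz MvPolynomial.X d D N) = 1 := by
    ext s t
    simp only [toeplitz, Matrix.of_apply, RingHom.mapMatrix_apply, Matrix.map_apply,
      Matrix.one_apply]
    by_cases hst : s = t
    · subst hst
      simp [hD]
    · have : (s : ℕ) ≠ t := fun h => hst (Fin.ext h)
      split_ifs with h
      · simp only [MvPolynomial.eval_X]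
        rw [if_neg (by omega)]
      · simp
  rw [h4, Matrix.det_one] at h3
  exact one_ne_zero h3

/-- A finite window of unknowns in a module satisfying the recurrences given by a Toeplitz regular
sequence vanishes. -/
theorem ToeplitzRegular.eq_zero_of_recurrence {γ : ℕ → K} (hγ : ToeplitzRegular γ)
    {Q : Type*} [AddCommGroup Q] [Module K Q] (M : ℕ → Q) {κ m d J₀ : ℕ}
    (hm : m + d ≤ J₀ + κ + 1) (hlow : ∀ a, a < κ → M a = 0) (hhigh : ∀ a, m ≤ a → M a = 0)
    (hrec : ∀ c, c + d ≤ J₀ → ∑ s ∈ Finset.range (d + 1), γ s • M (c + s) = 0) :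
    ∀ a, a ≤ J₀ → M a = 0 := by
  -- Only the values up to `J₀` occur in the recurrences and the conclusion, so `M` may be cut off
  -- beyond `J₀`.
  wlog hm' : m ≤ J₀ + 1 generalizing M m
  · intro a ha
    let M' : ℕ → Q := fun a => if a ≤ J₀ then M a else 0
    have := this M' (m := J₀ + 1) (by omega) (fun a h => by simp [M', hlow a h])
      (fun a h => by simp [M']; omega)
      (fun c hc => by
        rw [← hrec c hc]
        refine Finset.sum_congr rfl fun s hs => ?_
        have := Finset.mem_range.1 hs
        simp only [M']
        rw [if_pos (by omega)]) le_rfl a ha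
    simpa [M', ha] using this
  intro a ha
  rcases lt_or_ge a κ with h1 | h1
  · exact hlow a h1
  rcases le_or_gt m a with h2 | h2
  · exact hhigh a h2
  -- `D = min κ d`. The recurrences used start at `c = κ + t - D` for `t < N`: `D ≤ κ` makes this a
  -- true subtraction, and the last bound is `c + d ≤ J₀` for `t = N - 1`.
  obtain ⟨D, hDd, hDκ, hD⟩ : ∃ D, D ≤ d ∧ D ≤ κ ∧ m + d ≤ J₀ + D + 1 := by
    rcases le_total κ d with h | h
    · exact ⟨κ, h, le_rfl, hm⟩
    · exact ⟨d, le_rfl, h, by omega⟩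
  set N := m - κ with hN
  have hT : ∀ t : Fin N, ∑ s : Fin N, toeplitz γ d D N s t • M (κ + s) = 0 := by
    intro t
    have ht := t.2
    rw [← hrec (κ + t - D) (by omega)]
    simp only [toeplitz, Matrix.of_apply]
    rw [Fin.sum_univ_eq_sum_range
      (fun s => (if (t : ℕ) ≤ D + s ∧ D + s - t ≤ d then γ (D + s - t) else 0) • M (κ + s)) N]
    refine Finset.sum_bij_ne_zero (fun s _ _ => D + s - t) ?_ ?_ ?_ ?_
    · intro s _ h
      have : (t : ℕ) ≤ D + s ∧ D + s - t ≤ d := by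
        by_contra hc
        exact h (by rw [if_neg hc, zero_smul])
      simp; omega
    · intro s _ h s' _ h' e
      have : (t : ℕ) ≤ D + s ∧ D + s - t ≤ d := by
        by_contra hc
        exact h (by rw [if_neg hc, zero_smul])
      have : (t : ℕ) ≤ D + s' ∧ D + s' - t ≤ d := by
        by_contra hc
        exact h' (by rw [if_neg hc, zero_smul])
      omega
    · intro σ hσ h
      have hσ' := Finset.mem_range.1 hσ
      have hM : M (κ + t - D + σ) ≠ 0 := fun h0 => h (by simp [h0])
      have hl : κ ≤ κ + t - D + σ := by
        by_contra hc
        exact hM (hlow _ (by omega))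
      have hh : κ + t - D + σ < m := by
        by_contra hc
        exact hM (hhigh _ (by omega))
      have e1 : D + (t + σ - D) - t = σ := by omega
      have e2 : κ + (t + σ - D) = κ + t - D + σ := by omega
      refine ⟨t + σ - D, by simp; omega, ?_, e1⟩
      rw [e1, e2, if_pos (by omega)]
      exact h
    · intro s _ h
      have hc : (t : ℕ) ≤ D + s ∧ D + s - t ≤ d := by
        by_contra hc
        exact h (by rw [if_neg hc, zero_smul])
      rw [if_pos hc]
      congr 2
      omega
  -- The unknowns lie in a module, so the system is solved by multiplying with the adjugate.
  have hdet : ∀ s' : Fin N, (toeplitz γ d D N).det • M (κ + s') = 0 := by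
    intro s'
    have h3 : ∑ s : Fin N, (toeplitz γ d D N * (toeplitz γ d D N).adjugate) s s' • M (κ + s) =
        0 := by
      simp only [Matrix.mul_apply, Finset.sum_smul]
      rw [Finset.sum_comm]
      refine Finset.sum_eq_zero fun t _ => ?_
      have := congrArg (fun q => (toeplitz γ d D N).adjugate t s' • q) (hT t)
      simp only [Finset.smul_sum, smul_smul, smul_zero] at this
      rw [← this]
      exact Finset.sum_congr rfl fun s _ => by rw [mul_comm]
    rw [Matrix.mul_adjugate] at h3
    simpa [Matrix.smul_apply, Matrix.one_apply] using h3
  have := (smul_eq_zero.1 (hdet ⟨a - κ, by omega⟩)).resolve_left (hγ d D N hDd)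
  simpa [show κ + (a - κ) = a by omega] using this

end Toeplitz

/-! ### Surjectivity of powers of a linear form: adjoining one variable -/

section StanleyCover

variable {K R : Type*} [Field K] [CommRing R] [Algebra K R]

/-- The component of degree `j - e` of the family `V`, which is zero if `j < e`. -/
def shiftedPart (V : ℕ → Submodule K R) (e j : ℕ) : Submodule K R :=
  if e ≤ j then V (j - e) else ⊥

/-- Modulo `J`, every element of `V j` is a multiple of `ℓ ^ (2 j - δ)` by an element of
`V (δ - j)`; in particular it is zero if `j > δ`. -/
def StanleyCover (V : ℕ → Submodule K R) (J : Ideal R) (ℓ : R) (δ : ℕ) : Prop :=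
  ∀ j e, δ + e ≤ 2 * j → ∀ x ∈ V j, ∃ b ∈ shiftedPart V e j, x - ℓ ^ e * b ∈ J

/-- The span of the elements `ℓ ^ a * p` of degree `j` with `p` primitive modulo `J`. -/
def primitiveSpan (V : ℕ → Submodule K R) (J : Ideal R) (ℓ : R) (δ j : ℕ) : Submodule K R :=
  Submodule.span K {x | ∃ i a p, i + a = j ∧ 2 * i ≤ δ ∧ p ∈ V i ∧
    ℓ ^ (δ - 2 * i + 1) * p ∈ J ∧ x = ℓ ^ a * p}

theorem pow_mul_mem_primitiveSpan {V : ℕ → Submodule K R} {J : Ideal R} {ℓ : R} {δ j : ℕ}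
    (e : ℕ) {x : R} (hx : x ∈ J.restrictScalars K ⊔ primitiveSpan V J ℓ δ j) :
    ℓ ^ e * x ∈ J.restrictScalars K ⊔ primitiveSpan V J ℓ δ (j + e) := by
  suffices h : J.restrictScalars K ⊔ primitiveSpan V J ℓ δ j ≤
      (J.restrictScalars K ⊔ primitiveSpan V J ℓ δ (j + e)).comap (LinearMap.mulLeft K (ℓ ^ e)) from
    h hx
  refine sup_le (fun y hy => ?_) (Submodule.span_le.2 ?_)
  · exact Submodule.mem_sup_left (J.mul_mem_left _ hy)
  · rintro _ ⟨i, a, p, hia, hi, hp, hpJ, rfl⟩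
    refine Submodule.mem_sup_right (Submodule.subset_span ⟨i, a + e, p, by omega, hi, hp, hpJ, ?_⟩)
    simp only [LinearMap.mulLeft_apply]
    ring

/-- The primitive decomposition. -/
theorem StanleyCover.le_primitiveSpan {V : ℕ → Submodule K R} {J : Ideal R} {ℓ : R} {δ : ℕ}
    (hV : ∀ j, ∀ x ∈ V j, ∀ a, ℓ ^ a * x ∈ V (j + a)) (h : StanleyCover V J ℓ δ) (j : ℕ) :
    V j ≤ J.restrictScalars K ⊔ primitiveSpan V J ℓ δ j := by
  induction j using Nat.strong_induction_on with
  | _ j ih =>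
  intro x hx
  rcases le_or_gt (2 * j) δ with hj | hj
  -- The covering property just past degree `δ - j` gives `ℓ ^ (δ - 2j + 1) x ≡ ℓ ^ (δ - 2j + 2) b`.
  -- Hence `x - ℓ b` is primitive, and `b` has degree `j - 1`.
  · obtain ⟨b, hb, hbJ⟩ := h (j + (δ - 2 * j + 1)) (δ - 2 * j + 2) (by omega) _
      (hV j x hx (δ - 2 * j + 1))
    unfold shiftedPart at hb
    split_ifs at hb with hle
    · have e1 : j + (δ - 2 * j + 1) - (δ - 2 * j + 2) = j - 1 := by omega
      rw [e1] at hb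
      have h1 := pow_mul_mem_primitiveSpan 1 (ih (j - 1) (by omega) hb)
      have e2 : j - 1 + 1 = j := by omega
      rw [e2, pow_one] at h1
      have hlb : ℓ * b ∈ V j := by
        have := hV (j - 1) b hb 1
        rwa [e2, pow_one] at this
      have h2 : x - ℓ * b ∈ primitiveSpan V J ℓ δ j := by
        refine Submodule.subset_span ⟨j, 0, x - ℓ * b, rfl, hj, sub_mem hx hlb, ?_, by simp⟩
        convert hbJ using 1
        ring
      have := add_mem (Submodule.mem_sup_right (S := J.restrictScalars K) h2) h1
      simpa using this
    · rw [Submodule.mem_bot] at hb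
      subst hb
      refine Submodule.mem_sup_right (Submodule.subset_span ⟨j, 0, x, rfl, hj, hx, ?_, by simp⟩)
      simpa using hbJ
  -- Above the middle degree, `x` is modulo `J` a multiple of `ℓ ^ (2j - δ)` by an element of
  -- smaller degree, or zero.
  · obtain ⟨b, hb, hbJ⟩ := h j (2 * j - δ) (by omega) x hx
    unfold shiftedPart at hb
    split_ifs at hb with hle
    · have h1 := pow_mul_mem_primitiveSpan (2 * j - δ) (ih (j - (2 * j - δ)) (by omega) hb)
      rw [Nat.sub_add_cancel hle] at h1
      have := add_mem (Submodule.mem_sup_left (T := primitiveSpan V J ℓ δ j)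
        (S := J.restrictScalars K) hbJ) h1
      simpa using this
    · rw [Submodule.mem_bot] at hb
      subst hb
      exact Submodule.mem_sup_left (by simpa using hbJ)

/-- The binary form `∑ γ_s ℓ ^ s z ^ (d - s)`. -/
def binaryForm (γ : ℕ → K) (d : ℕ) (ℓ z : R) : R :=
  ∑ s ∈ Finset.range (d + 1), γ s • (ℓ ^ s * z ^ (d - s))

/-- The graded pieces obtained from `V` by adjoining `z` in degree one. -/
def adjoinDegreeOne (V : ℕ → Submodule K R) (z : R) (j : ℕ) : Submodule K R :=
  Submodule.span K {x | ∃ b k v, b + k = j ∧ v ∈ V k ∧ x = z ^ b * v}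

theorem pow_mul_mem_adjoinDegreeOne (V : ℕ → Submodule K R) (z : R) (j : ℕ) {x : R}
    (hx : x ∈ adjoinDegreeOne V z j) (a : ℕ) : z ^ a * x ∈ adjoinDegreeOne V z (j + a) := by
  suffices h : adjoinDegreeOne V z j ≤
      (adjoinDegreeOne V z (j + a)).comap (LinearMap.mulLeft K (z ^ a)) from h hx
  refine Submodule.span_le.2 ?_
  rintro _ ⟨b, k, v, hbk, hv, rfl⟩
  refine Submodule.subset_span ⟨a + b, k, v, by omega, hv, ?_⟩
  simp only [LinearMap.mulLeft_apply]
  ring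

theorem StanleyCover.adjoin {V : ℕ → Submodule K R} {J : Ideal R} {ℓ : R} {δ : ℕ}
    (hV : ∀ j, ∀ x ∈ V j, ∀ a, ℓ ^ a * x ∈ V (j + a)) (h : StanleyCover V J ℓ δ)
    {γ : ℕ → K} (hγ : ToeplitzRegular γ) (z : R) {d δ' : ℕ} (hδ' : δ' + 1 = δ + d) :
    StanleyCover (adjoinDegreeOne V z) (J ⊔ Ideal.span {binaryForm γ d ℓ z}) z δ' := by
  intro j e hje x hx
  set J' := J ⊔ Ideal.span {binaryForm γ d ℓ z} with hJ'
  set U : Submodule K R := J'.restrictScalars K ⊔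
    (shiftedPart (adjoinDegreeOne V z) e j).map (LinearMap.mulLeft K (z ^ e)) with hU
  have hJU : ∀ y ∈ J', y ∈ U := fun y hy => Submodule.mem_sup_left hy
  have hJJ' : ∀ y ∈ J, y ∈ J' := fun y hy => Ideal.mem_sup_left hy
  suffices hWU : adjoinDegreeOne V z j ≤ U by
    obtain ⟨u, hu, _, ⟨b, hb, rfl⟩, rfl⟩ := Submodule.mem_sup.1 (hWU hx)
    exact ⟨b, hb, by simpa using hu⟩
  refine Submodule.span_le.2 ?_
  rintro _ ⟨b, k, v, hbk, hv, rfl⟩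
  suffices hk : J.restrictScalars K ⊔ primitiveSpan V J ℓ δ k ≤
      U.comap (LinearMap.mulLeft K (z ^ b)) from hk (h.le_primitiveSpan hV k hv)
  refine sup_le (fun y hy => hJU _ (J'.mul_mem_left _ (hJJ' _ hy))) (Submodule.span_le.2 ?_)
  rintro _ ⟨i, a, p, hia, hi, hp, hpJ, rfl⟩
  set J₀ := a + b with hJ₀
  -- The elements of degree `j` on the string of `p`, modulo the target `U`. They vanish for `c ≤ J₀
  -- - e` because `z ^ e` can be split off, and for `c ≥ δ - 2i + 1` because `p` is primitive;
  -- multiples of the binary form give the recurrences between.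
  let M : ℕ → R ⧸ U := fun c => if c ≤ J₀ then U.mkQ (z ^ (J₀ - c) * (ℓ ^ c * p)) else 0
  have hM := hγ.eq_zero_of_recurrence M (κ := J₀ + 1 - e) (m := δ - 2 * i + 1) (d := d) (J₀ := J₀)
    -- With `J₀ = j - i` and `δ' + 1 = δ + d`, this bound is a consequence of `δ' + e ≤ 2j`.
    (by omega)
    (by
      intro c hc
      simp only [M]
      split_ifs with hcJ
      · rw [Submodule.mkQ_apply, Submodule.Quotient.mk_eq_zero]
        refine Submodule.mem_sup_right ⟨z ^ (J₀ - c - e) * (ℓ ^ c * p), ?_, ?_⟩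
        · unfold shiftedPart
          rw [if_pos (by omega)]
          exact Submodule.subset_span ⟨J₀ - c - e, i + c, _, by omega, hV i p hp c, rfl⟩
        · rw [LinearMap.mulLeft_apply, ← mul_assoc, ← pow_add]
          congr 2
          omega
      · rfl)
    (by
      intro c hc
      simp only [M]
      split_ifs with hcJ
      · rw [Submodule.mkQ_apply, Submodule.Quotient.mk_eq_zero]
        refine hJU _ (J'.mul_mem_left _ (hJJ' _ ?_))
        rw [← Nat.sub_add_cancel hc, pow_add, mul_assoc]
        exact J.mul_mem_left _ hpJ
      · rfl)
    (by
      intro c hc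
      have e1 : ∑ s ∈ Finset.range (d + 1), γ s • M (c + s) =
          U.mkQ ((z ^ (J₀ - c - d) * (ℓ ^ c * p)) * binaryForm γ d ℓ z) := by
        rw [binaryForm, Finset.mul_sum, map_sum]
        refine Finset.sum_congr rfl fun s hs => ?_
        have hs' := Finset.mem_range.1 hs
        simp only [M]
        rw [if_pos (by omega), ← map_smul, mul_smul_comm]
        congr 2
        rw [show J₀ - (c + s) = (J₀ - c - d) + (d - s) by omega]
        ring
      rw [e1, Submodule.mkQ_apply, Submodule.Quotient.mk_eq_zero]
      exact hJU _ (J'.mul_mem_left _ (Ideal.mem_sup_right (Ideal.subset_span rfl))))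
    a (by omega)
  simp only [M] at hM
  rw [if_pos (by omega), Submodule.mkQ_apply, Submodule.Quotient.mk_eq_zero] at hM
  simpa [hJ₀] using hM

/-- The span of the monomials of degree `j` in the first `r` elements of the sequence `y`. -/
def formsInFirst (K : Type*) {R : Type*} [Field K] [CommRing R] [Algebra K R] (y : ℕ → R) :
    ℕ → ℕ → Submodule K R
  | 0, j => if j = 0 then Submodule.span K {1} else ⊥
  | r + 1, j => adjoinDegreeOne (formsInFirst K y r) (y r) j

/-- The sequence `y` delayed by one and starting with zero. -/
def delayed (y : ℕ → R) : ℕ → R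
  | 0 => 0
  | r + 1 => y r

/-- The ideal generated by the binary forms in consecutive elements of the sequence `y`. -/
def binaryIdeal (γ : ℕ → K) (d : ℕ → ℕ) (y : ℕ → R) (r : ℕ) : Ideal R :=
  Ideal.span ((fun k => binaryForm γ (d k) (delayed y k) (y k)) '' Set.Iio r)

/-- Induction on the number of variables: each step adjoins `y r` and one binary form, raising `δ`
by `d r - 1`. It starts from the constants with `ℓ = 0` and `δ = 0`, so the first binary form is
just a multiple of a power of `y 0`. -/
theorem stanleyCover_binaryIdeal {γ : ℕ → K} (hγ : ToeplitzRegular γ) (d : ℕ → ℕ)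
    (hd : ∀ k, 0 < d k) (y : ℕ → R) (r δ : ℕ) (hδ : δ + r = ∑ k ∈ Finset.range r, d k) :
    StanleyCover (formsInFirst K y r) (binaryIdeal γ d y r) (delayed y r) δ := by
  induction r generalizing δ with
  | zero =>
    intro j e hje x hx
    rcases Nat.eq_zero_or_pos j with rfl | hj
    · obtain rfl : e = 0 := by omega
      exact ⟨x, by simpa [shiftedPart] using hx, by simp⟩
    · have : x = 0 := by simpa [formsInFirst, hj.ne'] using hx
      exact ⟨0, zero_mem _, by simp [this]⟩
  | succ r ih =>
    have hr : r ≤ ∑ k ∈ Finset.range r, d k := by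
      simpa using Finset.card_nsmul_le_sum (Finset.range r) d 1 (fun k _ => hd k)
    rw [Finset.sum_range_succ] at hδ
    have h1 := ih (∑ k ∈ Finset.range r, d k - r) (by omega)
    have hI : binaryIdeal γ d y (r + 1) =
        binaryIdeal γ d y r ⊔ Ideal.span {binaryForm γ (d r) (delayed y r) (y r)} := by
      rw [binaryIdeal, binaryIdeal, ← Ideal.span_union]
      congr 1
      have e : Set.Iio (r + 1) = Set.Iio r ∪ {r} := by
        ext k
        simp
      rw [e, Set.image_union, Set.image_singleton]
    rw [hI]
    refine StanleyCover.adjoin ?_ h1 hγ (y r) (by omega)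
    intro j x hx a
    -- Stability under `ℓ` is trivial at the start, where `ℓ = 0`; later `ℓ` is the variable
    -- adjoined last.
    cases r with
    | zero =>
      rcases Nat.eq_zero_or_pos a with rfl | ha
      · simpa using hx
      · simp [delayed, ha.ne']
    | succ r => exact pow_mul_mem_adjoinDegreeOne _ _ _ hx a

end StanleyCover

/-! ### Semicontinuity of dimensions under specialization -/

section Specialization

variable {σ : Type*}

/-- Linearly independent polynomials have a nonvanishing maximal minor. -/
theorem exists_coeff_det_ne_zero {L : Type*} [Field L] {k : ℕ} (v : Fin k → MvPolynomial σ L)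
    (hv : LinearIndependent L v) :
    ∃ e : Fin k → (σ →₀ ℕ),
      (Matrix.of fun i j => MvPolynomial.coeff (e i) (v j) : Matrix (Fin k) (Fin k) L).det ≠ 0 := by
  set w : (σ →₀ ℕ) → (Fin k → L) := fun a j => MvPolynomial.coeff a (v j) with hw
  -- A functional vanishing on all coefficient vectors `w a` would be a linear relation among the `v
  -- j`. Hence `k` of these vectors form a basis.
  have hspan : Submodule.span L (Set.range w) = ⊤ := by
    by_contra hne
    obtain ⟨f, hf, hle⟩ := Submodule.exists_le_ker_of_lt_top _ (lt_top_iff_ne_top.2 hne)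
    have hz : ∑ j, f (Pi.single j 1) • v j = 0 := by
      ext a
      have h1 : f (w a) = 0 := hle (Submodule.subset_span ⟨a, rfl⟩)
      rw [LinearMap.pi_apply_eq_sum_univ f (w a)] at h1
      simp only [MvPolynomial.coeff_sum, MvPolynomial.coeff_smul, MvPolynomial.coeff_zero]
      rw [← h1]
      refine Finset.sum_congr rfl fun j _ => ?_
      simp only [smul_eq_mul, hw]
      rw [mul_comm]
      congr 2
      ext i
      simp [Pi.single_apply, eq_comm]
    have hc := Fintype.linearIndependent_iff.1 hv _ hz
    apply hf
    ext j
    simpa using hc j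
  obtain ⟨f, hfs, -, hli⟩ := Submodule.exists_fun_fin_finrank_span_eq L (Set.range w)
  have hk : Module.finrank L (Submodule.span L (Set.range w)) = k := by
    rw [hspan, finrank_top, Module.finrank_fin_fun]
  choose e he using hfs
  refine ⟨fun i => e (Fin.cast hk.symm i), ?_⟩
  have h2 : LinearIndependent L (Matrix.of fun i j =>
      MvPolynomial.coeff (e (Fin.cast hk.symm i)) (v j) : Matrix (Fin k) (Fin k) L).row := by
    have h3 := hli.comp (Fin.cast hk.symm) (Fin.cast_injective _)
    have h4 : (Matrix.of fun i j =>
        MvPolynomial.coeff (e (Fin.cast hk.symm i)) (v j) : Matrix (Fin k) (Fin k) L).row =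
        f ∘ Fin.cast hk.symm := by
      ext i j
      simp only [Function.comp, ← he]
      rfl
    rw [h4]
    exact h3
  exact ((Matrix.isUnit_iff_isUnit_det _).1 (Matrix.linearIndependent_rows_iff_isUnit.1 h2)).ne_zero

/-- Linear independence of a family of polynomials is inherited from a specialization. -/
theorem linearIndependent_map_of_specialization {P K L : Type*} [CommRing P] [Field K] [Field L]
    {φ : P →+* K} (hφ : Function.Injective φ) (ψ : P →+* L) {k : ℕ}
    (u : Fin k → MvPolynomial σ P) (h : LinearIndependent L fun i => MvPolynomial.map ψ (u i)) :
    LinearIndependent K fun i => MvPolynomial.map φ (u i) := by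
  obtain ⟨e, he⟩ := exists_coeff_det_ne_zero _ h
  set A : Matrix (Fin k) (Fin k) P := Matrix.of fun i j => MvPolynomial.coeff (e i) (u j) with hA
  have h1 : ψ A.det ≠ 0 := by
    rw [RingHom.map_det]
    convert he using 2
    ext i j
    simp [A, MvPolynomial.coeff_map]
  have h2 : (φ.mapMatrix A).det ≠ 0 := by
    rw [← RingHom.map_det]
    intro h0
    exact h1 (by rw [(injective_iff_map_eq_zero φ).1 hφ _ h0, map_zero])
  rw [Fintype.linearIndependent_iff]
  intro g hg
  have h3 : (φ.mapMatrix A).mulVec g = 0 := by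
    ext i
    have := congrArg (MvPolynomial.coeff (e i)) hg
    simp only [MvPolynomial.coeff_sum, MvPolynomial.coeff_smul, MvPolynomial.coeff_zero,
      MvPolynomial.coeff_map, smul_eq_mul] at this
    simp only [Matrix.mulVec, dotProduct, RingHom.mapMatrix_apply, Matrix.map_apply, hA,
      Matrix.of_apply, Pi.zero_apply]
    rw [← this]
    exact Finset.sum_congr rfl fun j _ => mul_comm _ _
  have h4 := Matrix.eq_zero_of_mulVec_eq_zero h2 h3
  exact fun i => congrFun h4 i

/-- A basis of the specialized span can be chosen from the family; the members over the same indices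
stay independent under the injective `φ`. -/
theorem finrank_span_le_of_map_eq {P K L : Type*} [CommRing P] [Field K] [Field L]
    {φ : P →+* K} (hφ : Function.Injective φ) (ψ : P →+* L) {ι : Type*} [Finite ι]
    (u : ι → MvPolynomial σ P) {v : ι → MvPolynomial σ L} {w : ι → MvPolynomial σ K}
    (hv : ∀ i, MvPolynomial.map ψ (u i) = v i) (hw : ∀ i, MvPolynomial.map φ (u i) = w i) :
    Module.finrank L (Submodule.span L (Set.range v)) ≤
      Module.finrank K (Submodule.span K (Set.range w)) := by
  have : Module.Finite L (Submodule.span L (Set.range v)) :=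
    Module.Finite.span_of_finite L (Set.finite_range _)
  have : Module.Finite K (Submodule.span K (Set.range w)) :=
    Module.Finite.span_of_finite K (Set.finite_range _)
  obtain ⟨f, hfs, -, hli⟩ := Submodule.exists_fun_fin_finrank_span_eq L (Set.range v)
  choose e he using hfs
  have h1 := linearIndependent_map_of_specialization hφ ψ (fun i => u (e i))
    (by rw [show (fun i => MvPolynomial.map ψ (u (e i))) = f from
      funext fun i => (hv _).trans (he i)]; exact hli)
  have h2 := finrank_span_eq_card h1
  rw [Fintype.card_fin] at h2
  rw [← h2]
  refine Submodule.finrank_mono (Submodule.span_mono ?_)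
  rintro _ ⟨i, rfl⟩
  exact ⟨e i, (hw _).symm⟩

/-- The forms of degree `j` in the ideal `I`. -/
noncomputable def degreePart {K : Type*} [Field K] (I : Ideal (MvPolynomial σ K)) (j : ℕ) :
    Submodule K (MvPolynomial σ K) :=
  I.restrictScalars K ⊓ MvPolynomial.homogeneousSubmodule σ K j

theorem homogeneousComponent_mem_span_monomial_mul {K : Type*} [Field K] {ι : Type*} [Finite ι]
    {u : ι → MvPolynomial σ K} {d : ι → ℕ} (hu : ∀ k, (u k).IsHomogeneous (d k)) (j : ℕ)
    {x : MvPolynomial σ K} (hx : x ∈ Ideal.span (Set.range u)) :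
    MvPolynomial.homogeneousComponent j x ∈ Submodule.span K
      (Set.range fun p : {p : ι × (σ →₀ ℕ) // p.2.degree + d p.1 = j} =>
        MvPolynomial.monomial p.1.2 (1 : K) * u p.1.1) := by
  have := Fintype.ofFinite ι
  obtain ⟨c, rfl⟩ := Ideal.mem_span_range_iff_exists_fun.1 hx
  rw [map_sum]
  refine Submodule.sum_mem _ fun k _ => ?_
  induction c k using MvPolynomial.induction_on' with
  | monomial a b =>
    have hh : (MvPolynomial.monomial a b * u k).IsHomogeneous (a.degree + d k) :=
      (MvPolynomial.isHomogeneous_monomial b rfl).mul (hu k)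
    rw [MvPolynomial.homogeneousComponent_of_mem hh]
    split_ifs with h
    · have e : MvPolynomial.monomial a b * u k = b • (MvPolynomial.monomial a (1 : K) * u k) := by
        rw [← smul_mul_assoc, MvPolynomial.smul_monomial, smul_eq_mul, mul_one]
      rw [e]
      exact Submodule.smul_mem _ _ (Submodule.subset_span ⟨⟨(k, a), h.symm⟩, rfl⟩)
    · exact zero_mem _
  | add p q hp hq =>
    rw [add_mul, map_add]
    exact add_mem hp hq

/-- In a fixed degree only monomial multiples of the generators matter. These make sense over any
coefficient ring, which reduces the comparison of degree parts to that of spans of families. -/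
theorem degreePart_span {K : Type*} [Field K] {ι : Type*} [Finite ι]
    {u : ι → MvPolynomial σ K} {d : ι → ℕ} (hu : ∀ k, (u k).IsHomogeneous (d k)) (j : ℕ) :
    degreePart (Ideal.span (Set.range u)) j = Submodule.span K
      (Set.range fun p : {p : ι × (σ →₀ ℕ) // p.2.degree + d p.1 = j} =>
        MvPolynomial.monomial p.1.2 (1 : K) * u p.1.1) := by
  refine le_antisymm (fun x hx => ?_) (Submodule.span_le.2 ?_)
  · have := homogeneousComponent_mem_span_monomial_mul hu j hx.1
    rwa [MvPolynomial.homogeneousComponent_of_mem hx.2, if_pos rfl] at this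
  · rintro _ ⟨⟨⟨k, a⟩, hp⟩, rfl⟩
    refine ⟨Ideal.mul_mem_left _ _ (Ideal.subset_span ⟨k, rfl⟩), ?_⟩
    subst hp
    exact (MvPolynomial.isHomogeneous_monomial (1 : K) rfl).mul (hu k)

/-- The dimension of the degree `j` part of an ideal generated by forms does not increase under
specialization of the coefficients. -/
theorem finrank_degreePart_span_map_le [Finite σ] {P K L : Type*} [CommRing P] [Field K] [Field L]
    {φ : P →+* K} (hφ : Function.Injective φ) (ψ : P →+* L) {ι : Type*} [Finite ι]
    {u : ι → MvPolynomial σ P} {d : ι → ℕ} (hu : ∀ k, (u k).IsHomogeneous (d k)) (j : ℕ) :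
    Module.finrank L (degreePart (Ideal.span (Set.range fun i => MvPolynomial.map ψ (u i))) j) ≤
      Module.finrank K
        (degreePart (Ideal.span (Set.range fun i => MvPolynomial.map φ (u i))) j) := by
  rw [degreePart_span (fun k => (hu k).map ψ), degreePart_span (fun k => (hu k).map φ)]
  have : Finite {p : ι × (σ →₀ ℕ) // p.2.degree + d p.1 = j} := by
    refine Set.Finite.subset (Set.finite_univ.prod (Finsupp.finite_of_degree_le j)) ?_
    rintro ⟨k, a⟩ h
    have h' : a.degree + d k = j := h
    exact ⟨Set.mem_univ _, by simp; omega⟩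
  exact finrank_span_le_of_map_eq hφ ψ
    (fun p : {p : ι × (σ →₀ ℕ) // p.2.degree + d p.1 = j} =>
      MvPolynomial.monomial p.1.2 (1 : P) * u p.1.1)
    (fun p => by rw [map_mul, MvPolynomial.map_monomial, map_one])
    (fun p => by rw [map_mul, MvPolynomial.map_monomial, map_one])

end Specialization

/-! ### The special family of binary forms -/

section SpecialForms

variable {K : Type*} [Field K] {n : ℕ}

/-- The variables of a polynomial ring as an infinite sequence, continued by zero. -/
noncomputable def variableSeq (K : Type*) [Field K] (n k : ℕ) : MvPolynomial (Fin n) K :=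
  if h : k < n then MvPolynomial.X ⟨k, h⟩ else 0

theorem isHomogeneous_variableSeq (k : ℕ) : (variableSeq K n k).IsHomogeneous 1 := by
  unfold variableSeq
  split_ifs
  · exact MvPolynomial.isHomogeneous_X _ _
  · exact MvPolynomial.isHomogeneous_zero _ _ _

theorem monomial_mem_formsInFirst (r : ℕ) (hr : r ≤ n) (a : Fin n →₀ ℕ)
    (ha : ∀ k : Fin n, r ≤ k → a k = 0) :
    MvPolynomial.monomial a (1 : K) ∈ formsInFirst K (variableSeq K n) r a.degree := by
  induction r generalizing a with
  | zero =>
    obtain rfl : a = 0 := by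
      ext k
      exact ha k (Nat.zero_le _)
    simp [formsInFirst]
  | succ r ih =>
    refine Submodule.subset_span ⟨a ⟨r, hr⟩, (a.erase ⟨r, hr⟩).degree,
      MvPolynomial.monomial (a.erase ⟨r, hr⟩) 1, ?_, ?_, ?_⟩
    · conv_rhs => rw [← Finsupp.single_add_erase ⟨r, hr⟩ a]
      rw [map_add, Finsupp.degree_single]
    · refine ih (by omega) _ fun k hk => ?_
      by_cases hkr : k = ⟨r, hr⟩
      · rw [hkr, Finsupp.erase_same]
      · rw [Finsupp.erase_ne hkr]
        refine ha k ?_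
        have : (k : ℕ) ≠ r := fun h => hkr (Fin.ext h)
        omega
    · rw [variableSeq, dif_pos (show r < n from hr), MvPolynomial.X_pow_eq_monomial,
        MvPolynomial.monomial_mul, Finsupp.single_add_erase, mul_one]

theorem homogeneousSubmodule_le_span_monomial (j : ℕ) :
    MvPolynomial.homogeneousSubmodule (Fin n) K j ≤
      Submodule.span K ((fun a => MvPolynomial.monomial a (1 : K)) '' {a | a.degree = j}) := by
  intro x hx
  rw [x.as_sum]
  refine Submodule.sum_mem _ fun a ha => ?_
  have h1 : MvPolynomial.monomial a (x.coeff a) =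
      x.coeff a • MvPolynomial.monomial a (1 : K) := by
    rw [MvPolynomial.smul_monomial, smul_eq_mul, mul_one]
  rw [h1]
  refine Submodule.smul_mem _ _ (Submodule.subset_span ⟨a, ?_, rfl⟩)
  by_contra h
  exact (MvPolynomial.mem_support_iff.1 ha)
    (((MvPolynomial.mem_homogeneousSubmodule _ _).1 hx).coeff_eq_zero h)

theorem homogeneousSubmodule_le_formsInFirst (j : ℕ) :
    MvPolynomial.homogeneousSubmodule (Fin n) K j ≤ formsInFirst K (variableSeq K n) n j := by
  refine (homogeneousSubmodule_le_span_monomial j).trans (Submodule.span_le.2 ?_)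
  rintro _ ⟨a, rfl, rfl⟩
  exact monomial_mem_formsInFirst n le_rfl a fun k hk => absurd k.2 (by omega)

theorem binaryForm_isHomogeneous (γ : ℕ → K) (d : ℕ) {ℓ z : MvPolynomial (Fin n) K}
    (hl : ℓ.IsHomogeneous 1) (hz : z.IsHomogeneous 1) :
    (binaryForm γ d ℓ z).IsHomogeneous d := by
  rw [← MvPolynomial.mem_homogeneousSubmodule, binaryForm]
  refine Submodule.sum_mem _ fun s hs => Submodule.smul_mem _ _ ?_
  have h1 := (hl.pow s).mul (hz.pow (d - s))
  have h2 := Finset.mem_range.1 hs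
  rwa [show 1 * s + 1 * (d - s) = d by omega] at h1

/-- There are forms of prescribed degrees modulo which the last variable has the surjectivity
part of the strong Stanley property. -/
theorem exists_forms_stanleyCover {γ : ℕ → K} (hγ : ToeplitzRegular γ) (hn : 0 < n)
    (d : Fin n → ℕ) (hd : ∀ j, 0 < d j) {δ : ℕ} (hδ : δ + n = ∑ j, d j) :
    ∃ h : Fin n → MvPolynomial (Fin n) K, (∀ k, (h k).IsHomogeneous (d k)) ∧
      ∀ j e, δ + e ≤ 2 * j → MvPolynomial.homogeneousSubmodule (Fin n) K j ≤
        (Ideal.span (Set.range h) ⊔ Ideal.span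
          {MvPolynomial.X (⟨n - 1, Nat.sub_lt hn Nat.one_pos⟩ : Fin n) ^ e}).restrictScalars K := by
  let d' : ℕ → ℕ := fun k => if h : k < n then d ⟨k, h⟩ else 1
  let y := variableSeq K n
  have hy : ∀ k, (delayed y k).IsHomogeneous 1 := by
    rintro (_ | k)
    · exact MvPolynomial.isHomogeneous_zero _ _ _
    · exact isHomogeneous_variableSeq k
  refine ⟨fun k => binaryForm γ (d' k) (delayed y k) (y k), fun k => ?_, fun j e hje x hx => ?_⟩
  · have h1 := binaryForm_isHomogeneous γ (d' k) (hy k) (isHomogeneous_variableSeq (K := K) k)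
    simpa [d'] using h1
  · have hd' : ∀ k, 0 < d' k := by
      intro k
      simp only [d']
      split_ifs
      · exact hd _
      · exact Nat.one_pos
    have hsum : ∑ k ∈ Finset.range n, d' k = ∑ j, d j := by
      rw [← Fin.sum_univ_eq_sum_range]
      exact Finset.sum_congr rfl fun k _ => by simp [d']
    obtain ⟨b, -, hb⟩ := stanleyCover_binaryIdeal hγ d' hd' y n δ (by rw [hδ, hsum]) j e hje x
      (homogeneousSubmodule_le_formsInFirst j hx)
    have hz : delayed y n = MvPolynomial.X (⟨n - 1, Nat.sub_lt hn Nat.one_pos⟩ : Fin n) := by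
      obtain ⟨m, rfl⟩ := Nat.exists_eq_succ_of_ne_zero hn.ne'
      simp [delayed, y, variableSeq]
    have hI : binaryIdeal γ d' y n ≤
        Ideal.span (Set.range fun k : Fin n => binaryForm γ (d' k) (delayed y k) (y k)) := by
      refine Ideal.span_mono ?_
      rintro _ ⟨k, hk, rfl⟩
      exact ⟨⟨k, hk⟩, rfl⟩
    rw [← sub_add_cancel x (delayed y n ^ e * b)]
    refine add_mem (Ideal.mem_sup_left (hI hb)) (Ideal.mem_sup_right ?_)
    rw [hz]
    exact Ideal.mul_mem_right _ _ (Ideal.subset_span rfl)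

end SpecialForms

/-! ### Counting monomials -/

section Counting

variable {K : Type*} [Field K] {σ : Type*}

theorem finrank_span_monomial (S : Set (σ →₀ ℕ)) (hS : S.Finite) :
    Module.finrank K (Submodule.span K ((fun a => MvPolynomial.monomial a (1 : K)) '' S)) =
      S.ncard := by
  have := hS.fintype
  have h1 : LinearIndependent K fun a : S => MvPolynomial.monomial (a : σ →₀ ℕ) (1 : K) := by
    have := (MvPolynomial.basisMonomials σ K).linearIndependent.comp
      (fun a : S => (a : σ →₀ ℕ)) Subtype.val_injective
    simpa [MvPolynomial.coe_basisMonomials, Function.comp_def] using this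
  have h2 := finrank_span_eq_card h1
  rw [Set.image_eq_range, h2, ← Nat.card_eq_fintype_card, Nat.card_coe_set_eq]

theorem homogeneousSubmodule_eq_span_monomial {n : ℕ} (j : ℕ) :
    MvPolynomial.homogeneousSubmodule (Fin n) K j =
      Submodule.span K ((fun a => MvPolynomial.monomial a (1 : K)) '' {a | a.degree = j}) := by
  refine le_antisymm (homogeneousSubmodule_le_span_monomial j) (Submodule.span_le.2 ?_)
  rintro _ ⟨a, rfl, rfl⟩
  exact MvPolynomial.isHomogeneous_monomial _ rfl

theorem finrank_homogeneousSubmodule {n : ℕ} (j : ℕ) :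
    Module.finrank K (MvPolynomial.homogeneousSubmodule (Fin n) K j) =
      {a : Fin n →₀ ℕ | a.degree = j}.ncard := by
  rw [homogeneousSubmodule_eq_span_monomial,
    finrank_span_monomial _ (Finsupp.finite_of_degree_eq j)]

instance finite_homogeneousSubmodule {n : ℕ} (j : ℕ) :
    Module.Finite K (MvPolynomial.homogeneousSubmodule (Fin n) K j) :=
  Module.Finite.iff_fg.2 (MvPolynomial.homogeneousSubmodule_fg _ _ j)

instance finite_degreePart {n : ℕ} (I : Ideal (MvPolynomial (Fin n) K)) (j : ℕ) :
    Module.Finite K (degreePart I j) :=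
  Submodule.finiteDimensional_of_le (inf_le_right :
    degreePart I j ≤ MvPolynomial.homogeneousSubmodule (Fin n) K j)

/-- The selection `s` covers both the full family of powers and its initial segments. -/
theorem mem_span_X_pow {ι : Type*} (s : ι → σ) (d : σ → ℕ) (x : MvPolynomial σ K) :
    x ∈ Ideal.span (Set.range fun k : ι => (MvPolynomial.X (s k) : MvPolynomial σ K) ^ d (s k)) ↔
      ∀ a ∈ x.support, ∃ k, d (s k) ≤ a (s k) := by
  have h1 : (Set.range fun k : ι => (MvPolynomial.X (s k) : MvPolynomial σ K) ^ d (s k)) =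
      (fun a => MvPolynomial.monomial a (1 : K)) ''
        Set.range fun k => Finsupp.single (s k) (d (s k)) := by
    rw [← Set.range_comp]
    congr 1
    ext1 k
    exact MvPolynomial.X_pow_eq_monomial
  rw [h1, MvPolynomial.mem_ideal_span_monomial_image]
  simp

/-- The Hilbert function of a monomial complete intersection counts monomials. -/
theorem finrank_degreePart_span_X_pow {n : ℕ} (d : Fin n → ℕ) (j : ℕ) :
    Module.finrank K (degreePart (Ideal.span
        (Set.range fun k => (MvPolynomial.X k : MvPolynomial (Fin n) K) ^ d k)) j) +
      {a : Fin n →₀ ℕ | a.degree = j ∧ ∀ k, a k < d k}.ncard =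
    Module.finrank K (MvPolynomial.homogeneousSubmodule (Fin n) K j) := by
  have h1 : degreePart (Ideal.span
      (Set.range fun k => (MvPolynomial.X k : MvPolynomial (Fin n) K) ^ d k)) j =
      Submodule.span K ((fun a => MvPolynomial.monomial a (1 : K)) ''
        {a | a.degree = j ∧ ∃ k, d k ≤ a k}) := by
    refine le_antisymm (fun x hx => ?_) (Submodule.span_le.2 ?_)
    · have h2 := (mem_span_X_pow id d x).1 hx.1
      rw [x.as_sum]
      refine Submodule.sum_mem _ fun a ha => ?_
      have h1 : MvPolynomial.monomial a (x.coeff a) =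
          x.coeff a • MvPolynomial.monomial a (1 : K) := by
        rw [MvPolynomial.smul_monomial, smul_eq_mul, mul_one]
      rw [h1]
      refine Submodule.smul_mem _ _ (Submodule.subset_span ⟨a, ⟨?_, h2 a ha⟩, rfl⟩)
      by_contra h
      exact (MvPolynomial.mem_support_iff.1 ha)
        (((MvPolynomial.mem_homogeneousSubmodule _ _).1 hx.2).coeff_eq_zero h)
    · rintro _ ⟨a, ⟨rfl, ha⟩, rfl⟩
      refine ⟨(mem_span_X_pow id d _).2 fun b hb => ?_, MvPolynomial.isHomogeneous_monomial _ rfl⟩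
      obtain rfl : b = a := by
        simpa using MvPolynomial.support_monomial_subset hb
      exact ha
  have hfin := Finsupp.finite_of_degree_eq (σ := Fin n) j
  rw [h1, finrank_homogeneousSubmodule,
    finrank_span_monomial _ (hfin.subset fun a ha => ha.1),
    ← Set.ncard_union_eq ?_ (hfin.subset fun a ha => ha.1) (hfin.subset fun a ha => ha.1)]
  · congr 1
    ext a
    simp only [Set.mem_union, Set.mem_ofPred_eq, ← and_or_left, and_iff_left_iff_imp]
    intro _
    by_cases h : ∃ k, d k ≤ a k
    · exact Or.inl h
    · exact Or.inr (by simpa using h)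
  · rw [Set.disjoint_left]
    rintro a ⟨-, k, hk⟩ ⟨-, h⟩
    exact absurd (h k) (not_lt.2 hk)

/-- Symmetry of the Hilbert function of a monomial complete intersection. -/
theorem ncard_box_symm {n : ℕ} (d : Fin n → ℕ) (hd : ∀ k, 0 < d k) {δ : ℕ}
    (hδ : δ + n = ∑ k, d k) {i : ℕ} (hi : i ≤ δ) :
    {a : Fin n →₀ ℕ | a.degree = i ∧ ∀ k, a k < d k}.ncard =
      {a : Fin n →₀ ℕ | a.degree = δ - i ∧ ∀ k, a k < d k}.ncard := by
  -- The top corner of the box has degree `δ`, and `a ↦ c - a` exchanges degrees `i` and `δ - i`.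
  let c : Fin n →₀ ℕ := Finsupp.equivFunOnFinite.symm fun k => d k - 1
  have hc : ∀ k, c k = d k - 1 := fun k => rfl
  have hcd : c.degree = δ := by
    have h1 : ∑ k, (d k - 1) + n = ∑ k, d k := by
      have h2 : ∑ k : Fin n, d k = ∑ k, ((d k - 1) + 1) :=
        Finset.sum_congr rfl fun k _ => by have := hd k; omega
      rw [h2, Finset.sum_add_distrib]
      simp
    rw [Finsupp.degree_eq_sum]
    simp only [hc]
    omega
  have hle : ∀ a : Fin n →₀ ℕ, (∀ k, a k < d k) → a ≤ c := fun a ha k => by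
    have := ha k
    rw [hc]
    omega
  have hdeg : ∀ a : Fin n →₀ ℕ, a ≤ c → a.degree + (c - a).degree = δ := fun a ha => by
    rw [← map_add, add_tsub_cancel_of_le ha, hcd]
  have hlt : ∀ a : Fin n →₀ ℕ, ∀ k, (c - a) k < d k := fun a k => by
    have := hd k
    rw [Finsupp.tsub_apply, hc]
    omega
  refine Set.ncard_congr (fun a _ => c - a) ?_ ?_ ?_
  · rintro a ⟨h1, h2⟩
    have := hdeg a (hle a h2)
    exact ⟨by omega, hlt a⟩
  · rintro a b ⟨_, ha⟩ ⟨_, hb⟩ h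
    rw [← tsub_tsub_cancel_of_le (hle a ha), h, tsub_tsub_cancel_of_le (hle b hb)]
  · rintro b ⟨h1, h2⟩
    have := hdeg b (hle b h2)
    exact ⟨c - b, ⟨by omega, hlt b⟩, tsub_tsub_cancel_of_le (hle b h2)⟩

end Counting

/-! ### Hilbert functions when forms are added one by one -/

section HilbertFunction

attribute [local instance] MvPolynomial.gradedAlgebra

variable {K : Type*} [Field K] {n : ℕ}

theorem isHomogeneous_span_range {σ ι : Type*} {u : ι → MvPolynomial σ K} {d : ι → ℕ}
    (hu : ∀ k, (u k).IsHomogeneous (d k)) :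
    (Ideal.span (Set.range u)).IsHomogeneous (MvPolynomial.homogeneousSubmodule σ K) :=
  Ideal.homogeneous_span _ _ (by rintro _ ⟨k, rfl⟩; exact ⟨d k, hu k⟩)

theorem homogeneousComponent_mul_of_isHomogeneous {σ : Type*} {f : MvPolynomial σ K} {d : ℕ}
    (hf : f.IsHomogeneous d) (q : MvPolynomial σ K) (j : ℕ) :
    MvPolynomial.homogeneousComponent j (f * q) =
      if d ≤ j then f * MvPolynomial.homogeneousComponent (j - d) q else 0 := by
  induction q using MvPolynomial.induction_on' with
  | monomial a b =>
    have h1 : (MvPolynomial.monomial a b).IsHomogeneous a.degree :=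
      MvPolynomial.isHomogeneous_monomial b rfl
    rw [MvPolynomial.homogeneousComponent_of_mem (hf.mul h1),
      MvPolynomial.homogeneousComponent_of_mem h1]
    split_ifs <;> first | rfl | omega | simp
  | add p q hp hq =>
    rw [mul_add, map_add, map_add, hp, hq]
    split_ifs
    · ring
    · simp

/-- A form in `I + (f)` is the sum of a form in `I` and a multiple of `f` by a form. -/
theorem exists_eq_add_mul_of_mem_sup_span {σ : Type*} {I : Ideal (MvPolynomial σ K)}
    (hI : I.IsHomogeneous (MvPolynomial.homogeneousSubmodule σ K)) {f : MvPolynomial σ K} {d : ℕ}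
    (hf : f.IsHomogeneous d) {j : ℕ} {x : MvPolynomial σ K} (hx : x.IsHomogeneous j)
    (hxI : x ∈ I ⊔ Ideal.span {f}) :
    (d ≤ j ∧ ∃ u ∈ degreePart I j, ∃ q : MvPolynomial σ K, q.IsHomogeneous (j - d) ∧
      x = u + f * q) ∨ (j < d ∧ x ∈ degreePart I j) := by
  obtain ⟨u, hu, v, hv, rfl⟩ := Submodule.mem_sup.1 hxI
  obtain ⟨q, rfl⟩ := Ideal.mem_span_singleton'.1 hv
  have h1 := MvPolynomial.homogeneousComponent_eq_self hx
  rw [map_add, mul_comm q f, homogeneousComponent_mul_of_isHomogeneous hf] at h1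
  have h2 : MvPolynomial.homogeneousComponent j u ∈ degreePart I j :=
    ⟨MvPolynomial.homogeneousComponent_mem_of_mem hI hu j,
      MvPolynomial.homogeneousComponent_mem j u⟩
  split_ifs at h1 with h
  · exact Or.inl ⟨h, _, h2, _, MvPolynomial.homogeneousComponent_mem _ _,
      by rw [h1, mul_comm f q]⟩
  · rw [add_zero] at h1
    refine Or.inr ⟨not_le.1 h, ?_⟩
    rw [mul_comm q f, ← h1]
    exact h2

variable {I : Ideal (MvPolynomial (Fin n) K)} {f : MvPolynomial (Fin n) K} {d : ℕ}

theorem degreePart_sup_span_of_lt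
    (hI : I.IsHomogeneous (MvPolynomial.homogeneousSubmodule (Fin n) K)) (hf : f.IsHomogeneous d)
    {j : ℕ} (hj : j < d) : degreePart (I ⊔ Ideal.span {f}) j = degreePart I j := by
  refine le_antisymm (fun x hx => ?_) fun x hx => ⟨Ideal.mem_sup_left hx.1, hx.2⟩
  rcases exists_eq_add_mul_of_mem_sup_span hI hf hx.2 hx.1 with ⟨h, -⟩ | ⟨-, h⟩
  · omega
  · exact h

/-- The multiples of `f` by elements of a space `V` of polynomials. -/
noncomputable def multiples (f : MvPolynomial (Fin n) K)
    (V : Submodule K (MvPolynomial (Fin n) K)) : Submodule K (MvPolynomial (Fin n) K) :=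
  V.map (LinearMap.mulLeft K f)

theorem finrank_multiples (hf : f ≠ 0) (V : Submodule K (MvPolynomial (Fin n) K)) :
    Module.finrank K (multiples f V) = Module.finrank K V :=
  (Submodule.equivMapOfInjective (LinearMap.mulLeft K f) (mul_right_injective₀ hf)
    V).finrank_eq.symm

theorem degreePart_sup_span_of_le
    (hI : I.IsHomogeneous (MvPolynomial.homogeneousSubmodule (Fin n) K)) (hf : f.IsHomogeneous d)
    {j : ℕ} (hj : d ≤ j) : degreePart (I ⊔ Ideal.span {f}) j =
      degreePart I j ⊔ multiples f (MvPolynomial.homogeneousSubmodule (Fin n) K (j - d)) := by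
  refine le_antisymm (fun x hx => ?_) (sup_le (fun x hx => ⟨Ideal.mem_sup_left hx.1, hx.2⟩) ?_)
  · rcases exists_eq_add_mul_of_mem_sup_span hI hf hx.2 hx.1 with ⟨-, u, hu, q, hq, rfl⟩ | ⟨h, -⟩
    · exact add_mem (Submodule.mem_sup_left hu) (Submodule.mem_sup_right ⟨q, hq, rfl⟩)
    · omega
  · rintro _ ⟨q, hq, rfl⟩
    refine ⟨Ideal.mem_sup_right (Ideal.mul_mem_right _ _ (Ideal.subset_span rfl)), ?_⟩
    have h1 := hf.mul ((MvPolynomial.mem_homogeneousSubmodule _ _).1 hq)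
    rwa [Nat.add_sub_cancel' hj] at h1

/-- The gap in this inclusion measures the failure of `f` to be regular modulo `I` in degree `j -
d`. With the dimension formula for sums and intersections, it separates the inequality for an
arbitrary form from the equality for a regular one. -/
theorem multiples_degreePart_le (hf : f.IsHomogeneous d) {j : ℕ} (hj : d ≤ j) :
    multiples f (degreePart I (j - d)) ≤
      degreePart I j ⊓ multiples f (MvPolynomial.homogeneousSubmodule (Fin n) K (j - d)) := by
  rintro _ ⟨q, hq, rfl⟩
  refine ⟨⟨I.mul_mem_left _ hq.1, ?_⟩, ⟨q, hq.2, rfl⟩⟩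
  have h1 := hf.mul ((MvPolynomial.mem_homogeneousSubmodule _ _).1 hq.2)
  rwa [Nat.add_sub_cancel' hj] at h1

instance finiteDimensional_multiples (V : Submodule K (MvPolynomial (Fin n) K))
    [Module.Finite K V] :
    Module.Finite K (multiples f V) :=
  inferInstanceAs (Module.Finite K (V.map (LinearMap.mulLeft K f)))

/-- The Hilbert function does not drop by more than expected when a form is added. -/
theorem finrank_degreePart_sup_span_add_le
    (hI : I.IsHomogeneous (MvPolynomial.homogeneousSubmodule (Fin n) K)) (hf : f.IsHomogeneous d)
    (hf0 : f ≠ 0) {j : ℕ} (hj : d ≤ j) :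
    Module.finrank K (degreePart (I ⊔ Ideal.span {f}) j) +
        Module.finrank K (degreePart I (j - d)) ≤
      Module.finrank K (degreePart I j) +
        Module.finrank K (MvPolynomial.homogeneousSubmodule (Fin n) K (j - d)) := by
  rw [degreePart_sup_span_of_le hI hf hj, ← finrank_multiples hf0 (degreePart I (j - d)),
    ← finrank_multiples hf0 (MvPolynomial.homogeneousSubmodule (Fin n) K (j - d)),
    ← Submodule.finrank_sup_add_finrank_inf_eq (degreePart I j)]
  exact Nat.add_le_add_left (Submodule.finrank_mono (multiples_degreePart_le hf hj)) _

/-- The change of the Hilbert function when a form that is regular modulo `I` is added. -/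
theorem finrank_degreePart_sup_span_add_eq
    (hI : I.IsHomogeneous (MvPolynomial.homogeneousSubmodule (Fin n) K)) (hf : f.IsHomogeneous d)
    (hf0 : f ≠ 0) (hreg : ∀ q, f * q ∈ I → q ∈ I) {j : ℕ} (hj : d ≤ j) :
    Module.finrank K (degreePart (I ⊔ Ideal.span {f}) j) +
        Module.finrank K (degreePart I (j - d)) =
      Module.finrank K (degreePart I j) +
        Module.finrank K (MvPolynomial.homogeneousSubmodule (Fin n) K (j - d)) := by
  rw [degreePart_sup_span_of_le hI hf hj, ← finrank_multiples hf0 (degreePart I (j - d)),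
    ← finrank_multiples hf0 (MvPolynomial.homogeneousSubmodule (Fin n) K (j - d)),
    ← Submodule.finrank_sup_add_finrank_inf_eq (degreePart I j)]
  have h1 : multiples f (degreePart I (j - d)) =
      degreePart I j ⊓ multiples f (MvPolynomial.homogeneousSubmodule (Fin n) K (j - d)) := by
    refine le_antisymm (multiples_degreePart_le hf hj) ?_
    rintro x ⟨hx, q, hq, rfl⟩
    exact ⟨q, ⟨hreg q hx.1, hq⟩, rfl⟩
  rw [h1]

/-- The ideal generated by the first `r` members of a finite sequence of polynomials. -/
noncomputable def prefixIdeal (f : Fin n → MvPolynomial (Fin n) K) (r : ℕ) :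
    Ideal (MvPolynomial (Fin n) K) :=
  Ideal.span (Set.range fun k : {k : Fin n // k.val < r} => f k)

theorem prefixIdeal_succ (f : Fin n → MvPolynomial (Fin n) K) {r : ℕ} (hr : r < n) :
    prefixIdeal f (r + 1) = prefixIdeal f r ⊔ Ideal.span {f ⟨r, hr⟩} := by
  rw [prefixIdeal, prefixIdeal, ← Ideal.span_union]
  congr 1
  ext x
  constructor
  · rintro ⟨⟨k, hk⟩, rfl⟩
    rcases Nat.lt_succ_iff_lt_or_eq.1 hk with h | h
    · exact Or.inl ⟨⟨k, h⟩, rfl⟩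
    · exact Or.inr (congrArg f (Fin.ext h : k = ⟨r, hr⟩))
  · rintro (⟨⟨k, hk⟩, rfl⟩ | rfl)
    · exact ⟨⟨k, by omega⟩, rfl⟩
    · exact ⟨⟨⟨r, hr⟩, by simp⟩, rfl⟩

theorem prefixIdeal_self (f : Fin n → MvPolynomial (Fin n) K) :
    prefixIdeal f n = Ideal.span (Set.range f) := by
  rw [prefixIdeal]
  congr 1
  ext x
  constructor
  · rintro ⟨k, rfl⟩
    exact ⟨k, rfl⟩
  · rintro ⟨k, rfl⟩
    exact ⟨⟨k, k.2⟩, rfl⟩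

/-- Membership is read off from the exponents of the variables before the one with index `r`, which
multiplication by a power of the latter leaves unchanged. -/
theorem mem_prefixIdeal_X_pow_of_mul_mem (d : Fin n → ℕ) {r : ℕ} (hr : r < n)
    {q : MvPolynomial (Fin n) K}
    (hq : MvPolynomial.X ⟨r, hr⟩ ^ d ⟨r, hr⟩ * q ∈
      prefixIdeal (fun k => (MvPolynomial.X k : MvPolynomial (Fin n) K) ^ d k) r) :
    q ∈ prefixIdeal (fun k => (MvPolynomial.X k : MvPolynomial (Fin n) K) ^ d k) r := by
  rw [prefixIdeal, mem_span_X_pow (fun k : {k : Fin n // k.val < r} => k.1) d] at hq ⊢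
  intro a ha
  obtain ⟨⟨k, hk⟩, hka⟩ := hq (Finsupp.single ⟨r, hr⟩ (d ⟨r, hr⟩) + a) (by
    rw [MvPolynomial.mem_support_iff, MvPolynomial.X_pow_eq_monomial,
      MvPolynomial.coeff_monomial_mul, one_mul]
    exact MvPolynomial.mem_support_iff.1 ha)
  refine ⟨⟨k, hk⟩, ?_⟩
  have hne : (⟨r, hr⟩ : Fin n) ≠ k := fun h => by
    subst h
    exact lt_irrefl _ hk
  simpa [Finsupp.single_apply, hne] using hka

/-- If the Hilbert functions of all partial quotients by the forms `f₁, …, f_n` are bounded above by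
those of the monomial complete intersection of the same degrees, then they agree. -/
theorem finrank_degreePart_prefixIdeal_eq {f : Fin n → MvPolynomial (Fin n) K} {d : Fin n → ℕ}
    (hf : ∀ k, (f k).IsHomogeneous (d k)) (hf0 : ∀ k, f k ≠ 0)
    (hle : ∀ r j, Module.finrank K
        (degreePart (prefixIdeal (fun k => (MvPolynomial.X k : MvPolynomial (Fin n) K) ^ d k) r) j) ≤
      Module.finrank K (degreePart (prefixIdeal f r) j)) (r : ℕ) (hr : r ≤ n) (j : ℕ) :
    Module.finrank K (degreePart (prefixIdeal f r) j) = Module.finrank K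
      (degreePart (prefixIdeal (fun k => (MvPolynomial.X k : MvPolynomial (Fin n) K) ^ d k) r)
        j) := by
  induction r generalizing j with
  | zero =>
    have h (g : Fin n → MvPolynomial (Fin n) K) : prefixIdeal g 0 = ⊥ := by
      rw [prefixIdeal, Ideal.span_eq_bot]
      rintro _ ⟨⟨k, hk⟩, -⟩
      exact absurd hk (Nat.not_lt_zero _)
    rw [h, h]
  | succ r ih =>
    have hr' : r < n := hr
    refine le_antisymm ?_ (hle _ _)
    have hXh : ∀ k : Fin n, ((MvPolynomial.X k : MvPolynomial (Fin n) K) ^ d k).IsHomogeneous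
        (d k) := fun k => MvPolynomial.isHomogeneous_X_pow _ _
    have hI1 : (prefixIdeal f r).IsHomogeneous (MvPolynomial.homogeneousSubmodule (Fin n) K) :=
      isHomogeneous_span_range fun k : {k : Fin n // k.val < r} => hf k
    have hI2 : (prefixIdeal (fun k => (MvPolynomial.X k : MvPolynomial (Fin n) K) ^ d k)
        r).IsHomogeneous (MvPolynomial.homogeneousSubmodule (Fin n) K) :=
      isHomogeneous_span_range fun k : {k : Fin n // k.val < r} => hXh k
    rw [prefixIdeal_succ _ hr', prefixIdeal_succ _ hr']
    rcases lt_or_ge j (d ⟨r, hr'⟩) with hj | hj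
    · rw [degreePart_sup_span_of_lt hI1 (hf _) hj, degreePart_sup_span_of_lt hI2 (hXh _) hj,
        ih hr'.le]
    -- The inequality for `f` and the equality for the powers have the same remaining terms by
    -- induction.
    · have h1 := finrank_degreePart_sup_span_add_le hI1 (hf _) (hf0 _) hj
      have h2 := finrank_degreePart_sup_span_add_eq hI2 (hXh ⟨r, hr'⟩)
        (pow_ne_zero _ (MvPolynomial.X_ne_zero _))
        (fun q => mem_prefixIdeal_X_pow_of_mul_mem d hr') hj
      have h3 := ih hr'.le j
      have h4 := ih hr'.le (j - d ⟨r, hr'⟩)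
      omega

end HilbertFunction

/-! ### Generic forms compared with special ones -/

section GenericForms

/-- The indices of the coefficients of forms of degrees `d` in `n` variables. -/
abbrev CoeffIndex {ι : Type*} (n : ℕ) (d : ι → ℕ) : Type _ :=
  Σ j : ι, {a : Fin n →₀ ℕ // a.degree = d j}

theorem mem_toFinset_degree {n e : ℕ} {a : Fin n →₀ ℕ} :
    a ∈ (Finsupp.finite_of_degree_eq (σ := Fin n) e).toFinset ↔ a.degree = e := by
  rw [Set.Finite.mem_toFinset, Set.mem_ofPred_eq]

/-- The forms of degrees `d` whose coefficients are indeterminates. -/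
noncomputable def universalForm (F : Type*) [Field F] {n : ℕ} {ι : Type*} (d : ι → ℕ) (k : ι) :
    MvPolynomial (Fin n) (MvPolynomial (CoeffIndex n d) F) :=
  ∑ a ∈ (Finsupp.finite_of_degree_eq (σ := Fin n) (d k)).toFinset.attach,
    MvPolynomial.monomial a.1 (MvPolynomial.X ⟨k, a.1, mem_toFinset_degree.1 a.2⟩)

theorem universalForm_isHomogeneous (F : Type*) [Field F] {n : ℕ} {ι : Type*} (d : ι → ℕ)
    (k : ι) : (universalForm F (n := n) d k).IsHomogeneous (d k) :=
  MvPolynomial.IsHomogeneous.sum _ _ _ fun a _ =>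
    MvPolynomial.isHomogeneous_monomial _ (mem_toFinset_degree.1 a.2)

/-- Both generic and special forms arise from the universal ones by substituting coefficients, so
the semicontinuity applies to them. -/
theorem map_universalForm {F L : Type*} [Field F] [Field L] [Algebra F L] {n : ℕ} {ι : Type*}
    {d : ι → ℕ} {f : ι → MvPolynomial (Fin n) L} (hf : ∀ k, (f k).IsHomogeneous (d k)) (k : ι) :
    MvPolynomial.map (MvPolynomial.aeval (R := F)
      fun c : CoeffIndex n d => MvPolynomial.coeff c.2.1 (f c.1)).toRingHom
        (universalForm F d k) = f k := by
  rw [universalForm, map_sum]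
  simp only [MvPolynomial.map_monomial, AlgHom.toRingHom_eq_coe, RingHom.coe_coe,
    MvPolynomial.aeval_X]
  rw [Finset.sum_attach (Finsupp.finite_of_degree_eq (σ := Fin n) (d k)).toFinset
    (fun a => MvPolynomial.monomial a (MvPolynomial.coeff a (f k)))]
  conv_rhs => rw [(f k).as_sum]
  symm
  refine Finset.sum_subset (fun a ha => ?_) fun a _ ha => ?_
  · rw [mem_toFinset_degree]
    by_contra h
    exact (MvPolynomial.mem_support_iff.1 ha) ((hf k).coeff_eq_zero h)
  · rw [MvPolynomial.notMem_support_iff.1 ha, map_zero]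

variable {F K : Type*} [Field F] [Field K] [Algebra F K] {n : ℕ}

/-- The degree parts of an ideal generated by generic forms and fixed forms with coefficients in the
ground field have the largest possible dimension. -/
theorem finrank_degreePart_le_of_isGenericForms {r : ℕ} {d : Fin r → ℕ}
    {f : Fin r → MvPolynomial (Fin n) K} (hf : IsGenericForms F d f)
    {L : Type*} [Field L] [Algebra F L] {h : Fin r → MvPolynomial (Fin n) L}
    (hh : ∀ k, (h k).IsHomogeneous (d k)) {ι : Type*} [Finite ι] (s : ι → Fin r)
    {κ : Type*} [Finite κ] {w : κ → MvPolynomial (Fin n) F} {e : κ → ℕ}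
    (hw : ∀ k, (w k).IsHomogeneous (e k)) {v : κ → MvPolynomial (Fin n) L}
    {v' : κ → MvPolynomial (Fin n) K} (hv : ∀ k, MvPolynomial.map (algebraMap F L) (w k) = v k)
    (hv' : ∀ k, MvPolynomial.map (algebraMap F K) (w k) = v' k) (j : ℕ) :
    Module.finrank L (degreePart (Ideal.span (Set.range fun i => h (s i)) ⊔
        Ideal.span (Set.range v)) j) ≤
      Module.finrank K (degreePart (Ideal.span (Set.range fun i => f (s i)) ⊔
        Ideal.span (Set.range v')) j) := by
  set φ : MvPolynomial (CoeffIndex n d) F →+* K := (MvPolynomial.aeval (R := F)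
      fun c : CoeffIndex n d => MvPolynomial.coeff c.2.1 (f c.1)).toRingHom with hφ
  set ψ : MvPolynomial (CoeffIndex n d) F →+* L := (MvPolynomial.aeval (R := F)
      fun c : CoeffIndex n d => MvPolynomial.coeff c.2.1 (h c.1)).toRingHom with hψ
  -- Genericity enters here: algebraic independence of the coefficients is injectivity of the
  -- substitution.
  have hinj : Function.Injective φ := hf.2
  let u : ι ⊕ κ → MvPolynomial (Fin n) (MvPolynomial (CoeffIndex n d) F) :=
    Sum.elim (fun i => universalForm F d (s i)) fun i => MvPolynomial.map MvPolynomial.C (w i)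
  have h1 := finrank_degreePart_span_map_le hinj ψ (u := u)
    (d := Sum.elim (fun i => d (s i)) e) (by
      rintro (i | i)
      · exact universalForm_isHomogeneous F d (s i)
      · exact (hw i).map _) j
  have eK : (fun i => MvPolynomial.map φ (u i)) =
      Sum.elim (fun i => f (s i)) v' := by
    funext i
    rcases i with i | i
    · exact map_universalForm hf.1 (s i)
    · simp only [u, Sum.elim_inr, MvPolynomial.map_map, ← hv']
      congr 2
      ext x
      simp [φ]
  have eL : (fun i => MvPolynomial.map ψ (u i)) =
      Sum.elim (fun i => h (s i)) v := by
    funext i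
    rcases i with i | i
    · exact map_universalForm hh (s i)
    · simp only [u, Sum.elim_inr, MvPolynomial.map_map, ← hv]
      congr 2
      ext x
      simp [ψ]
  rwa [eK, eL, Set.Sum.elim_range, Set.Sum.elim_range, Ideal.span_union, Ideal.span_union] at h1

theorem IsGenericForms.ne_zero {d : Fin n → ℕ} {f : Fin n → MvPolynomial (Fin n) K}
    (hf : IsGenericForms F d f) (k : Fin n) : f k ≠ 0 := by
  intro h0
  have h1 := hf.2.ne_zero ⟨k, Finsupp.single k (d k), by simp⟩
  simp [h0] at h1

/-- The Hilbert function of a generic complete intersection. -/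
theorem IsGenericForms.finrank_degreePart_add {d : Fin n → ℕ}
    {f : Fin n → MvPolynomial (Fin n) K} (hf : IsGenericForms F d f) (j : ℕ) :
    Module.finrank K (degreePart (Ideal.span (Set.range f)) j) +
        {a : Fin n →₀ ℕ | a.degree = j ∧ ∀ k, a k < d k}.ncard =
      Module.finrank K (MvPolynomial.homogeneousSubmodule (Fin n) K j) := by
  rw [← finrank_degreePart_span_X_pow d j, ← prefixIdeal_self, ← prefixIdeal_self,
    finrank_degreePart_prefixIdeal_eq hf.1 hf.ne_zero ?_ n le_rfl]
  intro r j
  -- Specialization to powers of the variables, with the empty family of fixed forms.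
  have h1 := finrank_degreePart_le_of_isGenericForms hf (L := K)
    (h := fun k => (MvPolynomial.X k : MvPolynomial (Fin n) K) ^ d k)
    (fun k => MvPolynomial.isHomogeneous_X_pow _ _)
    (fun k : {k : Fin n // k.val < r} => k.1)
    (w := fun k : Empty => k.elim) (e := fun k => k.elim) (fun k => k.elim)
    (v := fun k => k.elim) (v' := fun k => k.elim) (fun k => k.elim) (fun k => k.elim) j
  rw [Set.range_eq_empty (ι := Empty), Ideal.span_empty, sup_bot_eq, sup_bot_eq] at h1
  exact h1

/-- The surjectivity part of the strong Stanley property for a generic complete intersection. -/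
theorem IsGenericForms.homogeneousSubmodule_le (hn : 0 < n) {d : Fin n → ℕ} (hd : ∀ j, 0 < d j)
    {f : Fin n → MvPolynomial (Fin n) K} (hf : IsGenericForms F d f) {δ : ℕ}
    (hδ : δ + n = ∑ j, d j) {j e : ℕ} (hje : δ + e ≤ 2 * j) :
    MvPolynomial.homogeneousSubmodule (Fin n) K j ≤
      (Ideal.span (Set.range f) ⊔ Ideal.span
        {MvPolynomial.X (⟨n - 1, Nat.sub_lt hn Nat.one_pos⟩ : Fin n) ^ e}).restrictScalars K := by
  -- The special forms live over the fraction field of `F[t₀, t₁, …]`, which need not be related to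
  -- `K`; only dimensions are compared.
  obtain ⟨h, hh, hcov⟩ :=
    exists_forms_stanleyCover (toeplitzRegular_indeterminates F) hn d hd hδ
  set z : Fin n := ⟨n - 1, Nat.sub_lt hn Nat.one_pos⟩
  have h1 := finrank_degreePart_le_of_isGenericForms hf hh (id : Fin n → Fin n)
    (w := fun _ : Unit => (MvPolynomial.X z : MvPolynomial (Fin n) F) ^ e) (e := fun _ => e)
    (fun _ => MvPolynomial.isHomogeneous_X_pow _ _)
    (v := fun _ => MvPolynomial.X z ^ e) (v' := fun _ => MvPolynomial.X z ^ e)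
    (fun _ => by rw [map_pow, MvPolynomial.map_X]) (fun _ => by rw [map_pow, MvPolynomial.map_X]) j
  rw [Set.range_const, Set.range_const] at h1
  have h2 : degreePart (Ideal.span (Set.range h) ⊔ Ideal.span {MvPolynomial.X z ^ e}) j =
      MvPolynomial.homogeneousSubmodule (Fin n) (FractionRing (MvPolynomial ℕ F)) j :=
    inf_eq_right.2 (hcov j e hje)
  erw [h2] at h1
  -- The space of all forms of degree `j` has the same dimension over both fields, so over `K` too
  -- the ideal contains all of them.
  rw [finrank_homogeneousSubmodule, ← finrank_homogeneousSubmodule (K := K)] at h1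
  exact inf_eq_right.1 (Submodule.eq_of_le_of_finrank_le inf_le_right h1)

end GenericForms

/-! ### Monomials in the initial ideal -/

section InitialIdeal

attribute [local instance] MvPolynomial.gradedAlgebra

variable {K σ : Type*} [Field K]

/-- A monomial of the initial ideal is divisible by the leading monomial of some `f ∈ I`, and
multiplying `f` by the quotient makes the monomial itself leading. -/
theorem monomial_mem_initialIdeal_iff (m : MonomialOrder σ) (I : Ideal (MvPolynomial σ K))
    (a : σ →₀ ℕ) :
    MvPolynomial.monomial a 1 ∈ initialIdeal m I ↔
      ∃ f ∈ I, MvPolynomial.coeff a f ≠ 0 ∧ ∀ b ∈ f.support, m.toSyn b ≤ m.toSyn a := by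
  constructor
  · intro h
    have hle : initialIdeal m I ≤ Ideal.span ((fun a => MvPolynomial.monomial a (1 : K)) ''
        {a | ∃ f ∈ I, f ≠ 0 ∧ m.degree f = a}) := by
      refine Ideal.span_le.2 ?_
      rintro _ ⟨f, hf, hf0, rfl⟩
      have h1 : m.leadingTerm f =
          MvPolynomial.C (m.leadingCoeff f) * MvPolynomial.monomial (m.degree f) 1 := by
        rw [MonomialOrder.leadingTerm, MvPolynomial.C_mul_monomial, mul_one]
      rw [h1]
      exact Ideal.mul_mem_left _ _ (Ideal.subset_span ⟨_, ⟨f, hf, hf0, rfl⟩, rfl⟩)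
    obtain ⟨_, ⟨f, hf, hf0, rfl⟩, hle'⟩ :=
      MvPolynomial.mem_ideal_span_monomial_image.1 (hle h) a (by
        classical
        rw [MvPolynomial.mem_support_iff, MvPolynomial.coeff_monomial, if_pos rfl]
        exact one_ne_zero)
    obtain ⟨c, rfl⟩ := exists_add_of_le hle'
    refine ⟨MvPolynomial.monomial c 1 * f, I.mul_mem_left _ hf, ?_, fun b hb => ?_⟩
    · rw [add_comm, MvPolynomial.coeff_monomial_mul, one_mul]
      exact m.coeff_degree_ne_zero_iff.2 hf0
    · rw [MvPolynomial.mem_support_iff, MvPolynomial.coeff_monomial_mul'] at hb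
      split_ifs at hb with hcb
      · obtain ⟨b, rfl⟩ := exists_add_of_le hcb
        rw [add_tsub_cancel_left, one_mul] at hb
        rw [add_comm c b, map_add, map_add]
        exact add_le_add_left (m.le_degree (MvPolynomial.mem_support_iff.2 hb)) _
      · exact absurd rfl hb
  · rintro ⟨f, hf, hfa, hle⟩
    have hdeg : m.degree f = a := m.toSyn.injective (le_antisymm (m.degree_le_iff.2 hle)
      (m.le_degree (MvPolynomial.mem_support_iff.2 hfa)))
    have hf0 : f ≠ 0 := fun h => hfa (by rw [h, MvPolynomial.coeff_zero])
    have h1 : MvPolynomial.monomial a 1 =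
        MvPolynomial.C (m.leadingCoeff f)⁻¹ * m.leadingTerm f := by
      rw [MonomialOrder.leadingTerm, MvPolynomial.C_mul_monomial,
        inv_mul_cancel₀ (m.leadingCoeff_ne_zero_iff.2 hf0), hdeg]
    rw [h1]
    exact Ideal.mul_mem_left _ _ (Ideal.subset_span ⟨f, hf, hf0, rfl⟩)

theorem monomial_mem_initialIdeal_iff_of_isHomogeneous (m : MonomialOrder σ)
    {I : Ideal (MvPolynomial σ K)}
    (hI : I.IsHomogeneous (MvPolynomial.homogeneousSubmodule σ K)) (a : σ →₀ ℕ) :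
    MvPolynomial.monomial a 1 ∈ initialIdeal m I ↔
      ∃ f ∈ I, f.IsHomogeneous a.degree ∧ MvPolynomial.coeff a f ≠ 0 ∧
        ∀ b ∈ f.support, m.toSyn b ≤ m.toSyn a := by
  rw [monomial_mem_initialIdeal_iff]
  constructor
  · rintro ⟨f, hf, hfa, hle⟩
    refine ⟨MvPolynomial.homogeneousComponent a.degree f,
      MvPolynomial.homogeneousComponent_mem_of_mem hI hf _,
      MvPolynomial.homogeneousComponent_mem _ _, ?_, fun b hb => hle b ?_⟩
    · rwa [MvPolynomial.coeff_homogeneousComponent, if_pos rfl]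
    · rw [MvPolynomial.support_homogeneousComponent] at hb
      exact (Finset.mem_filter.1 hb).1
  · rintro ⟨f, hf, -, h⟩
    exact ⟨f, hf, h⟩

end InitialIdeal

/-! ### From surjectivity to the strong Stanley property -/

section StrongStanley

attribute [local instance] MvPolynomial.gradedAlgebra

variable {K : Type*} [Field K] {n : ℕ}

theorem mem_gradedPart {σ : Type*} {I : Ideal (MvPolynomial σ K)} {i : ℕ}
    {x : MvPolynomial σ K ⧸ I} :
    x ∈ gradedPart I i ↔ ∃ q : MvPolynomial σ K, q.IsHomogeneous i ∧ Ideal.Quotient.mk I q = x :=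
  Iff.rfl

/-- If multiplication by `z ^ (δ - 2 i)` on `K[x] / J` is surjective onto the degree `δ - i` part,
then it is injective, by symmetry of the Hilbert function. -/
theorem mem_of_pow_mul_mem {J : Ideal (MvPolynomial (Fin n) K)}
    (hJ : J.IsHomogeneous (MvPolynomial.homogeneousSubmodule (Fin n) K))
    {z : MvPolynomial (Fin n) K} (hz : z.IsHomogeneous 1) (hz0 : z ≠ 0) {δ i N : ℕ}
    (hi : 2 * i ≤ δ)
    (hcov : MvPolynomial.homogeneousSubmodule (Fin n) K (δ - i) ≤
      (J ⊔ Ideal.span {z ^ (δ - 2 * i)}).restrictScalars K)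
    (h1 : Module.finrank K (degreePart J i) + N =
      Module.finrank K (MvPolynomial.homogeneousSubmodule (Fin n) K i))
    (h2 : Module.finrank K (degreePart J (δ - i)) + N =
      Module.finrank K (MvPolynomial.homogeneousSubmodule (Fin n) K (δ - i)))
    {q : MvPolynomial (Fin n) K} (hq : q.IsHomogeneous i) (hqJ : z ^ (δ - 2 * i) * q ∈ J) :
    q ∈ J := by
  have hze : (z ^ (δ - 2 * i)).IsHomogeneous (δ - 2 * i) := by
    simpa using hz.pow (δ - 2 * i)
  have hze0 : z ^ (δ - 2 * i) ≠ 0 := pow_ne_zero _ hz0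
  have hle : δ - 2 * i ≤ δ - i := by omega
  have h3 := degreePart_sup_span_of_le hJ hze hle
  have h4 : degreePart (J ⊔ Ideal.span {z ^ (δ - 2 * i)}) (δ - i) =
      MvPolynomial.homogeneousSubmodule (Fin n) K (δ - i) := inf_eq_right.2 hcov
  have h5 := Submodule.finrank_sup_add_finrank_inf_eq (degreePart J (δ - i))
    (multiples (z ^ (δ - 2 * i))
      (MvPolynomial.homogeneousSubmodule (Fin n) K (δ - i - (δ - 2 * i))))
  have h6 := multiples_degreePart_le (I := J) hze hle
  rw [← h3, h4, finrank_multiples hze0] at h5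
  rw [show δ - i - (δ - 2 * i) = i by omega] at h5 h6
  -- By surjectivity the sum of the two spaces is the whole degree part, so their intersection has
  -- dimension `dim R_i - N = dim J_i`.
  have h7 := Submodule.eq_of_le_of_finrank_le h6 (by
    rw [finrank_multiples hze0]
    omega)
  have h8 : z ^ (δ - 2 * i) * q ∈ multiples (z ^ (δ - 2 * i)) (degreePart J i) := by
    rw [h7]
    refine ⟨⟨hqJ, ?_⟩, q, hq, rfl⟩
    have := hze.mul hq
    rwa [show δ - 2 * i + i = δ - i by omega] at this
  obtain ⟨q', hq', he⟩ := h8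
  rw [← mul_right_injective₀ hze0 he]
  exact hq'.1

/-- The forms of degree above `δ` lie in `J`. -/
theorem mem_of_isHomogeneous_of_lt {J : Ideal (MvPolynomial (Fin n) K)}
    (hJ : J.IsHomogeneous (MvPolynomial.homogeneousSubmodule (Fin n) K))
    {z : MvPolynomial (Fin n) K} (hz : z.IsHomogeneous 1) {δ : ℕ}
    (hcov : ∀ j e, δ + e ≤ 2 * j → MvPolynomial.homogeneousSubmodule (Fin n) K j ≤
      (J ⊔ Ideal.span {z ^ e}).restrictScalars K)
    {j : ℕ} (hj : δ < j) {q : MvPolynomial (Fin n) K} (hq : q.IsHomogeneous j) : q ∈ J := by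
  -- The exponent `j + 1` is allowed since `δ < j`, and a form of degree `j` has no room for a
  -- multiple of `z ^ (j + 1)`.
  have hze : (z ^ (j + 1)).IsHomogeneous (j + 1) := by
    simpa using hz.pow (j + 1)
  rcases exists_eq_add_mul_of_mem_sup_span hJ hze hq (hcov j (j + 1) (by omega) hq) with
    ⟨h, -⟩ | ⟨-, h⟩
  · omega
  · exact h.1

theorem finite_quotient_of_forall_lt {J : Ideal (MvPolynomial (Fin n) K)} {δ : ℕ}
    (h : ∀ j, δ < j → ∀ q : MvPolynomial (Fin n) K, q.IsHomogeneous j → q ∈ J) :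
    Module.Finite K (MvPolynomial (Fin n) K ⧸ J) := by
  have h1 : (⨆ j ∈ Finset.range (δ + 1), gradedPart J j) = ⊤ := by
    refine eq_top_iff.2 fun x _ => ?_
    obtain ⟨p, rfl⟩ := Ideal.Quotient.mk_surjective x
    rw [← MvPolynomial.sum_homogeneousComponent p, map_sum]
    refine Submodule.sum_mem _ fun i _ => ?_
    have hi := MvPolynomial.homogeneousComponent_isHomogeneous i p
    rcases le_or_gt i δ with hiδ | hiδ
    · exact Submodule.mem_iSup_of_mem i (Submodule.mem_iSup_of_mem
        (Finset.mem_range.2 (by omega)) (mem_gradedPart.2 ⟨_, hi, rfl⟩))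
    · rw [Ideal.Quotient.eq_zero_iff_mem.2 (h i hiδ _ hi)]
      exact zero_mem _
  refine ⟨?_⟩
  rw [← h1]
  exact Submodule.fg_biSup _ _ fun j _ => (MvPolynomial.homogeneousSubmodule_fg _ _ j).map _

/-- Degree `δ` survives because `z ^ δ ∈ J` would force `1 ∈ J`. -/
theorem isGreatest_gradedPart_ne_bot {J : Ideal (MvPolynomial (Fin n) K)}
    (h1 : (1 : MvPolynomial (Fin n) K) ∉ J)
    {z : MvPolynomial (Fin n) K} (hz : z.IsHomogeneous 1) {δ : ℕ}
    (hlt : ∀ j, δ < j → ∀ q : MvPolynomial (Fin n) K, q.IsHomogeneous j → q ∈ J)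
    (hinj : ∀ q : MvPolynomial (Fin n) K, q.IsHomogeneous 0 → z ^ δ * q ∈ J → q ∈ J) :
    IsGreatest {i | gradedPart J i ≠ ⊥} δ := by
  constructor
  · intro hbot
    have h2 : Ideal.Quotient.mk J (z ^ δ) ∈ gradedPart J δ :=
      mem_gradedPart.2 ⟨z ^ δ, by simpa using hz.pow δ, rfl⟩
    rw [hbot, Submodule.mem_bot, Ideal.Quotient.eq_zero_iff_mem] at h2
    exact h1 (hinj 1 (MvPolynomial.isHomogeneous_one _ _) (by rwa [mul_one]))
  · intro j hj
    by_contra hlt'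
    refine hj (eq_bot_iff.2 ?_)
    intro x hx
    obtain ⟨q, hq, rfl⟩ := mem_gradedPart.1 hx
    rw [Submodule.mem_bot, Ideal.Quotient.eq_zero_iff_mem]
    exact hlt j (not_le.1 hlt') q hq

theorem bijOn_gradedPart {J : Ideal (MvPolynomial (Fin n) K)}
    (hJ : J.IsHomogeneous (MvPolynomial.homogeneousSubmodule (Fin n) K))
    {z : MvPolynomial (Fin n) K} (hz : z.IsHomogeneous 1) {δ i : ℕ} (hi : 2 * i ≤ δ)
    (hcov : MvPolynomial.homogeneousSubmodule (Fin n) K (δ - i) ≤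
      (J ⊔ Ideal.span {z ^ (δ - 2 * i)}).restrictScalars K)
    (hinj : ∀ q : MvPolynomial (Fin n) K, q.IsHomogeneous i → z ^ (δ - 2 * i) * q ∈ J → q ∈ J) :
    Set.BijOn (fun a => Ideal.Quotient.mk J z ^ (δ - 2 * i) * a)
      (gradedPart J i) (gradedPart J (δ - i)) := by
  have hze : (z ^ (δ - 2 * i)).IsHomogeneous (δ - 2 * i) := by
    simpa using hz.pow (δ - 2 * i)
  refine ⟨?_, ?_, ?_⟩
  · intro x hx
    obtain ⟨q, hq, rfl⟩ := mem_gradedPart.1 hx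
    refine mem_gradedPart.2 ⟨z ^ (δ - 2 * i) * q, ?_, by simp⟩
    have := hze.mul hq
    rwa [show δ - 2 * i + i = δ - i by omega] at this
  · intro x hx y hy hxy
    obtain ⟨q, hq, rfl⟩ := mem_gradedPart.1 hx
    obtain ⟨p, hp, rfl⟩ := mem_gradedPart.1 hy
    simp only [← map_pow, ← map_mul] at hxy
    rw [Ideal.Quotient.eq, ← mul_sub] at hxy
    exact Ideal.Quotient.eq.2 (hinj _ (hq.sub hp) hxy)
  · intro x hx
    obtain ⟨q, hq, rfl⟩ := mem_gradedPart.1 hx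
    rcases exists_eq_add_mul_of_mem_sup_span hJ hze hq (hcov hq) with
      ⟨-, u, hu, p, hp, rfl⟩ | ⟨h, -⟩
    · rw [show δ - i - (δ - 2 * i) = i by omega] at hp
      refine ⟨Ideal.Quotient.mk J p, mem_gradedPart.2 ⟨p, hp, rfl⟩, ?_⟩
      rw [map_add, Ideal.Quotient.eq_zero_iff_mem.2 hu.1, zero_add, map_mul, map_pow]
    · omega

end StrongStanley

/-! ### Standard monomials in the graded reverse lexicographic order -/

section GrevlexStandardMonomials

attribute [local instance] MvPolynomial.gradedAlgebra

variable {K : Type*} [Field K] {n : ℕ}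

theorem grevlex_le_iff_not_lt {a b : Fin n →₀ ℕ} :
    (grevlex n).toSyn a ≤ (grevlex n).toSyn b ↔ ¬ GrevLex.of n b < GrevLex.of n a :=
  not_lt.symm

/-- Among monomials of the same degree, those with larger exponent of the last variable are
smaller. -/
theorem grevlex_lt_of_last {l : Fin n} (hl : ∀ k, k ≤ l) {a b : Fin n →₀ ℕ}
    (hd : a.degree = b.degree) (h : b l < a l) : GrevLex.of n a < GrevLex.of n b :=
  GrevLex.lt_iff.2 (Or.inr ⟨hd, l, fun k hk => absurd (hl k) (not_le.2 hk), h⟩)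

theorem exists_eq_X_pow_mul {l : Fin n} {e i : ℕ} {f : MvPolynomial (Fin n) K}
    (hf : f.IsHomogeneous (e + i)) (h : ∀ b ∈ f.support, e ≤ b l) :
    ∃ g : MvPolynomial (Fin n) K, g.IsHomogeneous i ∧ f = MvPolynomial.X l ^ e * g := by
  have h1 : f ∈ Ideal.span
      ((fun a => MvPolynomial.monomial a (1 : K)) '' {Finsupp.single l e}) := by
    rw [MvPolynomial.mem_ideal_span_monomial_image]
    intro b hb
    exact ⟨_, rfl, Finsupp.single_le_iff.2 (h b hb)⟩
  rw [Set.image_singleton, Ideal.mem_span_singleton', ← MvPolynomial.X_pow_eq_monomial] at h1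
  obtain ⟨g, hg⟩ := h1
  have h2 := homogeneousComponent_mul_of_isHomogeneous
    (MvPolynomial.isHomogeneous_X_pow (R := K) l e) g (e + i)
  rw [mul_comm, hg, MvPolynomial.homogeneousComponent_eq_self hf, if_pos (Nat.le_add_right e i),
    Nat.add_sub_cancel_left] at h2
  exact ⟨_, MvPolynomial.homogeneousComponent_isHomogeneous i g, h2⟩

/-- The hypothesis `hcov` yields divisibility of the standard monomials of degree `δ - i` by the
power of the last variable; `hinj` shows that multiplying by this power preserves standardness. -/
theorem standardMonomials_eq_image {J : Ideal (MvPolynomial (Fin n) K)}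
    (hJ : J.IsHomogeneous (MvPolynomial.homogeneousSubmodule (Fin n) K)) {l : Fin n}
    (hl : ∀ k, k ≤ l) {δ i : ℕ} (hi : 2 * i ≤ δ)
    (hcov : MvPolynomial.homogeneousSubmodule (Fin n) K (δ - i) ≤
      (J ⊔ Ideal.span {MvPolynomial.X l ^ (δ - 2 * i)}).restrictScalars K)
    (hinj : ∀ q : MvPolynomial (Fin n) K, q.IsHomogeneous i →
      MvPolynomial.X l ^ (δ - 2 * i) * q ∈ J → q ∈ J) :
    standardMonomials (grevlex n) J (δ - i) =
      (fun p => MvPolynomial.X l ^ (δ - 2 * i) * p) '' standardMonomials (grevlex n) J i := by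
  set e := δ - 2 * i with he
  have hei : δ - i = e + i := by omega
  rw [hei] at hcov ⊢
  have hXm (a : Fin n →₀ ℕ) : MvPolynomial.X l ^ e * MvPolynomial.monomial a (1 : K) =
      MvPolynomial.monomial (Finsupp.single l e + a) 1 := by
    rw [MvPolynomial.X_pow_eq_monomial, MvPolynomial.monomial_mul, mul_one]
  ext p
  constructor
  · rintro ⟨a, ha, rfl, hin⟩
    -- Otherwise write `x^a = u + x_l ^ e q` with `u ∈ J`. Every monomial of `u` other than `x^a`
    -- has exponent of `x_l` at least `e`, hence is smaller, so `x^a` is the leading monomial of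
    -- `u`.
    have hle : e ≤ a l := by
      by_contra hlt
      refine hin ((monomial_mem_initialIdeal_iff _ _ _).2 ?_)
      rcases exists_eq_add_mul_of_mem_sup_span hJ (MvPolynomial.isHomogeneous_X_pow (R := K) l e)
        (MvPolynomial.isHomogeneous_monomial (1 : K) ha)
        (hcov (MvPolynomial.isHomogeneous_monomial (1 : K) ha)) with ⟨-, u, hu, q, hq, hs⟩ | ⟨h, -⟩
      · have hcoeff (b : Fin n →₀ ℕ) (hb : ¬ e ≤ b l) :
            MvPolynomial.coeff b (MvPolynomial.X l ^ e * q) = 0 := by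
          rw [MvPolynomial.X_pow_eq_monomial, MvPolynomial.coeff_monomial_mul',
            if_neg (fun h => hb (Finsupp.single_le_iff.1 h))]
        refine ⟨u, hu.1, ?_, fun b hb => ?_⟩
        · have h1 := congrArg (MvPolynomial.coeff a) hs
          rw [MvPolynomial.coeff_add, hcoeff a hlt, add_zero, MvPolynomial.coeff_monomial,
            if_pos rfl] at h1
          rw [← h1]
          exact one_ne_zero
        · by_cases hba : b = a
          · rw [hba]
          have hbd : b.degree = e + i := by
            by_contra h
            exact (MvPolynomial.mem_support_iff.1 hb) (MvPolynomial.IsHomogeneous.coeff_eq_zero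
              hu.2 h)
          have hbl : e ≤ b l := by
            by_contra hbl
            have h1 := congrArg (MvPolynomial.coeff b) hs
            rw [MvPolynomial.coeff_add, hcoeff b hbl, add_zero, MvPolynomial.coeff_monomial,
              if_neg (Ne.symm hba)] at h1
            exact (MvPolynomial.mem_support_iff.1 hb) h1.symm
          exact (grevlex_lt_of_last hl (hbd.trans ha.symm) (by omega)).le
      · omega
    obtain ⟨c, rfl⟩ := exists_add_of_le (Finsupp.single_le_iff.2 hle)
    rw [map_add, Finsupp.degree_single] at ha
    refine ⟨MvPolynomial.monomial c 1, ⟨c, by omega, rfl, fun hc => hin ?_⟩, hXm c⟩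
    rw [← hXm]
    exact Ideal.mul_mem_left _ _ hc
  · rintro ⟨_, ⟨a, ha, rfl, hin⟩, rfl⟩
    refine ⟨Finsupp.single l e + a, by rw [map_add, Finsupp.degree_single, ha], hXm a,
      fun hc => hin ?_⟩
    dsimp only at hc
    rw [hXm, monomial_mem_initialIdeal_iff_of_isHomogeneous _ hJ] at hc
    obtain ⟨f, hf, hfh, hfa, hfle⟩ := hc
    rw [map_add, Finsupp.degree_single, ha] at hfh
    -- A monomial of `f` with exponent of `x_l` below `e` would exceed the leading one, so `x_l ^ e`
    -- divides `f`; by `hinj` the quotient lies in `J`, and its leading monomial is `x^a`.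
    obtain ⟨g, hg, rfl⟩ := exists_eq_X_pow_mul (l := l) hfh fun b hb => by
      by_contra hlt
      refine grevlex_le_iff_not_lt.1 (hfle b hb) (grevlex_lt_of_last hl ?_ ?_)
      · rw [map_add, Finsupp.degree_single, ha]
        by_contra h
        exact (MvPolynomial.mem_support_iff.1 hb) (hfh.coeff_eq_zero (Ne.symm h))
      · rw [Finsupp.add_apply, Finsupp.single_eq_same]
        omega
    rw [MvPolynomial.X_pow_eq_monomial, MvPolynomial.coeff_monomial_mul, one_mul] at hfa
    refine (monomial_mem_initialIdeal_iff _ _ _).2 ⟨g, hinj g hg hf, hfa, fun b hb => ?_⟩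
    have h1 := hfle (Finsupp.single l e + b) (by
      rw [MvPolynomial.mem_support_iff, MvPolynomial.X_pow_eq_monomial,
        MvPolynomial.coeff_monomial_mul, one_mul]
      exact MvPolynomial.mem_support_iff.1 hb)
    rw [grevlex_le_iff_not_lt, add_comm _ a, add_comm _ b, GrevLex.add_lt_add_right_iff] at h1
    exact grevlex_le_iff_not_lt.2 h1

end GrevlexStandardMonomials

/-! ### The main theorem -/

theorem mainTheorem6 {F K : Type*} [Field F] [Field K] [Algebra F K]
    (n : ℕ) (hn : 0 < n) (d : Fin n → ℕ) (hd : ∀ j, 0 < d j)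
    (J : Ideal (MvPolynomial (Fin n) K)) (hJ : IsGenericIdeal F d J)
    (δ : ℕ) (hδ : δ + n = ∑ j, d j) :
    (∀ i : ℕ, 2 * i ≤ δ →
      standardMonomials (grevlex n) J (δ - i) =
        (fun p => MvPolynomial.X (⟨n - 1, Nat.sub_lt hn Nat.one_pos⟩ : Fin n) ^ (δ - 2 * i) * p) ''
          standardMonomials (grevlex n) J i) ∧
    IsGreatest {i | gradedPart J i ≠ ⊥} δ ∧
    HasStrongStanleyProperty J ∧
    IsStrongStanleyElement J
      (MvPolynomial.X (⟨n - 1, Nat.sub_lt hn Nat.one_pos⟩ : Fin n)) := by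
  obtain ⟨f, hf, rfl⟩ := hJ
  set l : Fin n := ⟨n - 1, Nat.sub_lt hn Nat.one_pos⟩ with hl
  have hlast : ∀ k, k ≤ l := fun k => Fin.le_def.2 (Nat.le_sub_one_of_lt k.2)
  have hhom := isHomogeneous_span_range (K := K) hf.1
  have hz : (MvPolynomial.X l : MvPolynomial (Fin n) K).IsHomogeneous 1 :=
    MvPolynomial.isHomogeneous_X _ _
  have hcov : ∀ j e, δ + e ≤ 2 * j → MvPolynomial.homogeneousSubmodule (Fin n) K j ≤
      (Ideal.span (Set.range f) ⊔ Ideal.span {MvPolynomial.X l ^ e}).restrictScalars K :=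
    fun j e h => hf.homogeneousSubmodule_le hn hd hδ h
  have hinj : ∀ i, 2 * i ≤ δ → ∀ q : MvPolynomial (Fin n) K, q.IsHomogeneous i →
      MvPolynomial.X l ^ (δ - 2 * i) * q ∈ Ideal.span (Set.range f) →
        q ∈ Ideal.span (Set.range f) := by
    intro i hi q hq hqJ
    refine mem_of_pow_mul_mem hhom hz (MvPolynomial.X_ne_zero l) hi (hcov _ _ (by omega))
      (hf.finrank_degreePart_add i) ?_ hq hqJ
    -- Degrees `i` and `δ - i` must share the same codimension `N`; this is the symmetry of the box.
    rw [ncard_box_symm d hd hδ (by omega : i ≤ δ)]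
    exact hf.finrank_degreePart_add (δ - i)
  have hlt : ∀ j, δ < j → ∀ q : MvPolynomial (Fin n) K, q.IsHomogeneous j →
      q ∈ Ideal.span (Set.range f) :=
    fun j hj q hq => mem_of_isHomogeneous_of_lt hhom hz hcov hj hq
  have hone : (1 : MvPolynomial (Fin n) K) ∉ Ideal.span (Set.range f) := by
    have hle : Ideal.span (Set.range f) ≤ RingHom.ker MvPolynomial.constantCoeff := by
      refine Ideal.span_le.2 ?_
      rintro _ ⟨k, rfl⟩
      refine (hf.1 k).coeff_eq_zero ?_
      rw [map_zero]
      exact (hd k).ne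
    intro h
    have := hle h
    rw [RingHom.mem_ker, map_one] at this
    exact one_ne_zero this
  have hgreat := isGreatest_gradedPart_ne_bot hone hz hlt (by simpa using hinj 0 (by omega))
  have hstanley : IsStrongStanleyElement (Ideal.span (Set.range f)) (MvPolynomial.X l) :=
    ⟨hhom, finite_quotient_of_forall_lt hlt, hz, δ, hgreat, fun i hi =>
      bijOn_gradedPart hhom hz (by omega) (hcov _ _ (by omega)) (hinj i (by omega))⟩
  exact ⟨fun i hi => standardMonomials_eq_image hhom hlast hi (hcov _ _ (by omega)) (hinj i hi),
    hgreat, ⟨_, hstanley⟩, hstanley⟩
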